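/- Let $K$ be a field of characteristic zero and $I$ a finite non-empty set. Let $\mathcal{H}_I$ be the Connes–Kreimer Hopf algebra of rooted trees decorated by $I$, that is, the polynomial algebra on these trees, graded by the number of vertices, with the coproduct $\Delta(t)=t\otimes 1+\sum_c P^c(t)\otimes R^c(t)$ for every tree $t$, the sum being over the non-total admissible cuts $c$ of $t$ (the empty cut included), where $R^c(t)$ is the part containing the root and $P^c(t)$ the pruned forest. For $i\in I$ let $F_i\in K[[h_j,\ j\in I]]$ be a non-constant formal series with constant term $1$, and let $(X_i)_{i\in I}$ be the unique solution, in the completion of $\mathcal{H}_I$, of the system $(S)$: $X_i=B_i^+(F_i(X_j,\ j\in I))$ for all $i \in I$, where $B_i^+$ grafts the trees of a forest on a common root decorated by $i$. Let $X_i(n)$ be the homogeneous component of degree $n$ of $X_i$, let $a_t$ be the coefficient of a tree $t$ in $X_i$, where $i$ decorates the root of $t$, and let $\mathcal{H}_{(S)}$ be the subalgebra of $\mathcal{H}_I$ generated by all the $X_i(n)$. Assume that $(S)$ is Hopf, i.e. that $\mathcal{H}_{(S)}$ is a Hopf subalgebra of $\mathcal{H}_I$. Then there are scalars $\lambda_n^{(i,j)}$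 ($i,j\in I$, $n\geq 1$) such that for every tree $t'$ with $n$ vertices and root decorated by $i$, $$\sum_t n_j(t,t')\,a_t=\lambda_n^{(i,j)}a_{t'},$$ where $t$ runs over the trees with $n+1$ vertices and root decorated by $i$, and $n_j(t,t')$ is the number of leaves of $t$ decorated by $j$ whose cut gives $t'$. Let $\mathfrak{g}_{(S)}=\mathrm{Prim}(\mathcal{H}_{(S)}^*)$ be the Lie algebra of the primitive elements of the graded dual of $\mathcal{H}_{(S)}$. For $f,g\in\mathfrak{g}_{(S)}$ there is a unique $f\star g\in\mathfrak{g}_{(S)}$ such that $(f\star g)(x)=(f\otimes g)\circ(\pi\otimes\pi)\circ\Delta(x)$ for all $x$ in the span of the $X_i(n)$, where $\pi$ is the projection on the span of the trees that vanishes on the forests that are not trees. The product $\star$ is bilinear and pre-Lie, $(f\star g)\star h-f\star(g\star h)=(g\star f)\star h-g\star(f\star h)$; it induces the Lie bracket of $\mathfrak{g}_{(S)}$, $[f,g]=f\star g-g\star f$; and it is inherited, by restriction of linear forms to $\mathcal{H}_{(S)}$, from the pre-Lie product of $\mathrm{Prim}(\mathcal{H}_I^*)$ given on every tree $t$ by $(f\star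 g)(t)=(f\otimes g)\circ(\pi\otimes\pi)\circ\Delta(t)$. Moreover $\mathfrak{g}_{(S)}$ has a basis $(f_i(k))_{i\in I,\,k\geq 1}$ which is dual to the homogeneous components of the solution, in the sense that $f_i(k)(X_j(l))=1$ if $(i,k)=(j,l)$ and $0$ otherwise, and for all $i,j\in I$ and $k,l\geq 1$: $$f_j(l)\star f_i(k)=\lambda_k^{(i,j)}f_i(k+l).$$ -/

import Mathlib

open scoped TensorProduct

namespace DSE

/-! ### Decorated rooted trees -/

/-- Plane rooted trees with vertices decorated by `D`: a decorated root together with the list of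
the subtrees hanging from it. -/
inductive PTree (D : Type*) : Type _
  | node : D → List (PTree D) → PTree D

/-- One elementary change of plane structure: permuting the subtrees of the root, or changing the
plane structure of one of these subtrees. -/
inductive PTree.Rel {D : Type*} : PTree D → PTree D → Prop
  | perm (d : D) (l l' : List (PTree D)) (h : l.Perm l') :
      PTree.Rel (PTree.node d l) (PTree.node d l')
  | child (d : D) (l r : List (PTree D)) (t t' : PTree D) (h : PTree.Rel t t') :
      PTree.Rel (PTree.node d (l ++ t :: r)) (PTree.node d (l ++ t' :: r))

/-- (Non-plane) rooted trees decorated by `D`. -/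
def RTree (D : Type*) : Type _ := Quot (PTree.Rel (D := D))

/-- The rooted tree underlying a plane rooted tree. -/
def RTree.mk {D : Type*} (t : PTree D) : RTree D := Quot.mk _ t

/-- The decoration of the root of a plane tree. -/
def PTree.root {D : Type*} : PTree D → D
  | PTree.node d _ => d

/-- The multiset of the (non-plane) subtrees hanging from the root of a plane tree. -/
def PTree.children {D : Type*} : PTree D → Multiset (RTree D)
  | PTree.node _ l => (l.map RTree.mk : List (RTree D))

/-- The decoration of the root. -/
def RTree.root {D : Type*} (t : RTree D) : D :=
  Quot.liftOn t PTree.root (by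
    intro a b h
    cases h <;> rfl)

/-- The multiset of the subtrees hanging from the root. -/
def RTree.children {D : Type*} (t : RTree D) : Multiset (RTree D) :=
  Quot.liftOn t PTree.children (by
    intro a b h
    cases h with
    | perm d l l' h => exact Multiset.coe_eq_coe.2 (h.map _)
    | child d l r t t' h =>
      have : RTree.mk t = RTree.mk t' := Quot.sound h
      simp [PTree.children, this])

/-- A plane representative of a rooted tree. -/
noncomputable def RTree.out {D : Type*} (t : RTree D) : PTree D := Quot.out t

theorem RTree.mk_out {D : Type*} (t : RTree D) : RTree.mk t.out = t := Quot.out_eq t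

/-- Grafting a multiset of rooted trees on a common root decorated by `d`. -/
noncomputable def RTree.node {D : Type*} (d : D) (m : Multiset (RTree D)) : RTree D :=
  Quot.liftOn m (fun l => RTree.mk (PTree.node d (l.map RTree.out))) (by
    intro a b h
    exact Quot.sound (PTree.Rel.perm d _ _ (List.Perm.map _ h)))

theorem RTree.mk_node_congr {D : Type*} (d : D) (l l' : List (PTree D))
    (h : l.map RTree.mk = l'.map RTree.mk) (p : List (PTree D)) :
    RTree.mk (PTree.node d (p ++ l)) = RTree.mk (PTree.node d (p ++ l')) := by
  induction l generalizing l' p with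
  | nil =>
    cases l' with
    | nil => rfl
    | cons a l' => simp at h
  | cons a l ih =>
    cases l' with
    | nil => simp at h
    | cons b l' =>
      simp only [List.map_cons, List.cons.injEq] at h
      have h1 : RTree.mk (PTree.node d (p ++ a :: l)) = RTree.mk (PTree.node d (p ++ b :: l)) := by
        have hab : Relation.EqvGen PTree.Rel a b := Quot.eqvGen_exact h.1
        induction hab with
        | rel x y hxy => exact Quot.sound (PTree.Rel.child d p l x y hxy)
        | refl x => rfl
        | symm x y _ ih' => exact (ih' ⟨h.1.symm, h.2⟩).symm
        | trans x y z hxy hyz ih1 ih2 =>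
          have e1 : RTree.mk x = RTree.mk y := Quot.eqvGen_sound hxy
          have e2 : RTree.mk y = RTree.mk z := Quot.eqvGen_sound hyz
          exact (ih1 ⟨e1, h.2⟩).trans (ih2 ⟨e2, h.2⟩)
      have h2 := ih l' h.2 (p ++ [b])
      simp only [List.append_assoc, List.singleton_append] at h2
      exact h1.trans h2

theorem RTree.mk_node {D : Type*} (d : D) (l : List (PTree D)) :
    RTree.mk (PTree.node d l) = RTree.node d (l.map RTree.mk : List (RTree D)) := by
  have : (l.map RTree.mk) = ((l.map RTree.mk).map RTree.out).map RTree.mk := by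
    simp [RTree.mk_out]
  exact RTree.mk_node_congr d _ _ this []

@[simp]
theorem RTree.root_node {D : Type*} (d : D) (m : Multiset (RTree D)) :
    (RTree.node d m).root = d := by
  induction m using Quotient.inductionOn with
  | _ l => rfl

@[simp]
theorem RTree.children_node {D : Type*} (d : D) (m : Multiset (RTree D)) :
    (RTree.node d m).children = m := by
  induction m using Quotient.inductionOn with
  | _ l =>
    change (((l.map RTree.out).map RTree.mk : List (RTree D)) : Multiset (RTree D)) = (l : Multiset _)
    congr 1
    simp [Function.comp_def, RTree.mk_out]

@[simp]
theorem RTree.node_root_children {D : Type*} (t : RTree D) :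
    RTree.node t.root t.children = t := by
  induction t using Quot.inductionOn with
  | _ p =>
    cases p with
    | node d l => exact (RTree.mk_node d l).symm

mutual
/-- The number of vertices of a plane tree. -/
def PTree.weight {D : Type*} : PTree D → ℕ
  | PTree.node _ l => 1 + PTree.weightList l
/-- The number of vertices of a plane forest. -/
def PTree.weightList {D : Type*} : List (PTree D) → ℕ
  | [] => 0
  | t :: l => PTree.weight t + PTree.weightList l
end

theorem PTree.weightList_eq {D : Type*} (l : List (PTree D)) :
    PTree.weightList l = (l.map PTree.weight).sum := by
  induction l with
  | nil => rfl
  | cons a l ih => simp [PTree.weightList, ih]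

theorem PTree.Rel.weight_eq {D : Type*} {a b : PTree D} (h : PTree.Rel a b) :
    a.weight = b.weight := by
  induction h with
  | perm d l l' h => simp [PTree.weight, PTree.weightList_eq, (h.map _).sum_eq]
  | child d l r t t' h ih => simp [PTree.weight, PTree.weightList_eq, ih]

/-- The weight of a rooted tree: the number of its vertices. -/
def RTree.weight {D : Type*} (t : RTree D) : ℕ :=
  Quot.liftOn t PTree.weight (fun _ _ h => h.weight_eq)

theorem RTree.weight_node {D : Type*} (d : D) (m : Multiset (RTree D)) :
    (RTree.node d m).weight = 1 + (m.map RTree.weight).sum := by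
  induction m using Quotient.inductionOn with
  | _ l =>
    change 1 + PTree.weightList (l.map RTree.out) = 1 + (l.map RTree.weight).sum
    rw [PTree.weightList_eq, List.map_map]
    congr 2
    apply List.map_congr_left
    intro a _
    conv_rhs => rw [← RTree.mk_out a]
    rfl

theorem RTree.weight_pos {D : Type*} (t : RTree D) : 0 < t.weight := by
  rw [← RTree.node_root_children t, RTree.weight_node]
  omega

/-! ### Admissible cuts -/

mutual
/-- The non-total admissible cuts `c` of a tree (the empty cut included), listed with multiplicity
through the pairs `(P^c, R^c)`, the pruned forest and the tree that keeps the root. -/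
noncomputable def PTree.cuts {D : Type*} : PTree D → Multiset (Multiset (RTree D) × RTree D)
  | PTree.node d l => (PTree.cutsList l).map (fun c => (c.1, RTree.node d c.2))
/-- The admissible cuts of a list of subtrees hanging from a common root: for each subtree `t`,
either the edge between the root and `t` is cut, so that `t` is pruned and nothing of it remains,
or it is not cut, and a non-total admissible cut of `t` is chosen. -/
noncomputable def PTree.cutsList {D : Type*} :
    List (PTree D) → Multiset (Multiset (RTree D) × Multiset (RTree D))
  | [] => {(0, 0)}
  | t :: l =>
    (({RTree.mk t}, 0) ::ₘ (PTree.cuts t).map (fun c => (c.1, {c.2}))).bind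
      (fun c => (PTree.cutsList l).map (fun c' => (c.1 + c'.1, c.2 + c'.2)))
end

theorem PTree.cutsList_perm {D : Type*} {l l' : List (PTree D)} (h : l.Perm l') :
    PTree.cutsList l = PTree.cutsList l' := by
  induction h with
  | nil => rfl
  | cons x _ ih => simp only [PTree.cutsList, ih]
  | swap x y l =>
    simp only [PTree.cutsList, Multiset.map_bind, Multiset.map_map, Function.comp_def]
    rw [Multiset.bind_bind]
    simp only [add_left_comm]
  | trans _ _ ih1 ih2 => exact ih1.trans ih2

theorem PTree.Rel.cuts_eq {D : Type*} {a b : PTree D} (h : PTree.Rel a b) :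
    a.cuts = b.cuts := by
  induction h with
  | perm d l l' h => simp only [PTree.cuts, PTree.cutsList_perm h]
  | child d l r t t' h ih =>
    have hm : RTree.mk t = RTree.mk t' := Quot.sound h
    have key : PTree.cutsList (l ++ t :: r) = PTree.cutsList (l ++ t' :: r) := by
      induction l with
      | nil => simp only [List.nil_append, PTree.cutsList, ih, hm]
      | cons x l ihl => simp only [List.cons_append, PTree.cutsList, ihl]
    simp only [PTree.cuts, key]

/-- The non-total admissible cuts `c` of a rooted tree (the empty cut included), listed with
multiplicity through the pairs `(P^c, R^c)`. -/
noncomputable def RTree.cuts {D : Type*} (t : RTree D) :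
    Multiset (Multiset (RTree D) × RTree D) :=
  Quot.liftOn t PTree.cuts (fun _ _ h => h.cuts_eq)

open Classical in
/-- `cutNumber p r t` is the number of admissible cuts `c` of `t` whose pruned forest `P^c(t)` is
the single tree `p` and such that `R^c(t) = r`. -/
noncomputable def RTree.cutNumber {D : Type*} (p r t : RTree D) : ℕ :=
  t.cuts.count ({p}, r)

/-- The tree with a single vertex. -/
noncomputable def RTree.dot {D : Type*} (d : D) : RTree D := RTree.node d 0

/-! ### The Hopf algebra of decorated rooted trees -/

/-- The algebra of decorated rooted trees: polynomials in the trees.  Its monomials are the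
forests. -/
abbrev HopfTree (K D : Type*) [Field K] : Type _ := MvPolynomial (RTree D) K

/-- The coproduct: the algebra morphism that sends a tree `t` to
`t ⊗ 1 + ∑ P^c(t) ⊗ R^c(t)`, where `c` runs over the non-total admissible cuts of `t`. -/
noncomputable def comul (K D : Type*) [Field K] :
    HopfTree K D →ₐ[K] HopfTree K D ⊗[K] HopfTree K D :=
  MvPolynomial.aeval fun t : RTree D =>
    MvPolynomial.X t ⊗ₜ[K] 1 +
      (t.cuts.map fun c =>
        (c.1.map (MvPolynomial.X (R := K))).prod ⊗ₜ[K] MvPolynomial.X c.2).sum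

/-- The counit: it sends every nonempty forest to `0`. -/
noncomputable def counit (K D : Type*) [Field K] : HopfTree K D →ₐ[K] K :=
  MvPolynomial.aeval fun _ => 0

/-- The projection on the span of the trees that vanishes on the forests that are not trees. -/
noncomputable def treeProj (K D : Type*) [Field K] : HopfTree K D →ₗ[K] HopfTree K D :=
  MvPolynomial.homogeneousComponent 1

/-- `x` is homogeneous of degree `n`: it is a combination of forests with `n` vertices. -/
def IsHomog {K D : Type*} [Field K] (x : HopfTree K D) (n : ℕ) : Prop :=
  MvPolynomial.IsWeightedHomogeneous RTree.weight x n

/-! ### Finiteness of the sets of trees and forests of given weight -/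

theorem finite_weight_le (D : Type*) [Finite D] (n : ℕ) :
    {t : RTree D | t.weight ≤ n}.Finite := by
  classical
  induction n with
  | zero =>
    convert Set.finite_empty
    ext t
    have := t.weight_pos
    simp
    omega
  | succ n ih =>
    have h1 : (Set.Iic (n • ih.toFinset.val)).Finite := Set.finite_Iic _
    refine (Set.Finite.image (fun p : D × Multiset (RTree D) => RTree.node p.1 p.2)
      (Set.finite_univ.prod h1)).subset ?_
    intro t ht
    refine ⟨(t.root, t.children), ⟨Set.mem_univ _, ?_⟩, RTree.node_root_children t⟩
    have ht' : 1 + (t.children.map RTree.weight).sum ≤ n + 1 := by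
      have := RTree.weight_node t.root t.children
      rw [RTree.node_root_children] at this
      rw [← this]
      exact ht
    change t.children ≤ n • ih.toFinset.val
    rw [Multiset.le_iff_count]
    intro a
    rw [Multiset.count_nsmul]
    by_cases ha : a ∈ t.children
    · have hw : a.weight ≤ (t.children.map RTree.weight).sum :=
        Multiset.single_le_sum (fun _ _ => Nat.zero_le _) _ (Multiset.mem_map_of_mem _ ha)
      have hmem : a ∈ ih.toFinset.val := by
        rw [Finset.mem_val, Set.Finite.mem_toFinset]
        change a.weight ≤ n
        omega
      rw [Multiset.count_eq_one_of_mem ih.toFinset.nodup hmem, mul_one]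
      have hc : t.children.card ≤ (t.children.map RTree.weight).sum := by
        have := Multiset.card_nsmul_le_sum (s := t.children.map RTree.weight) (a := 1) (by
          intro x hx
          obtain ⟨y, _, rfl⟩ := Multiset.mem_map.1 hx
          exact y.weight_pos)
        simpa using this
      have := Multiset.count_le_card a t.children
      omega
    · rw [Multiset.count_eq_zero_of_notMem ha]
      exact Nat.zero_le _

/-- The weight of a forest (seen as the exponent of a monomial): its number of vertices. -/
noncomputable def forestWeight {D : Type*} (e : RTree D →₀ ℕ) : ℕ :=
  Finsupp.weight RTree.weight e

theorem finite_forestWeight_eq (D : Type*) [Finite D] (n : ℕ) :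
    {e : RTree D →₀ ℕ | forestWeight e = n}.Finite := by
  classical
  have h := finite_weight_le D n
  refine (Set.finite_Iic (∑ t ∈ h.toFinset, Finsupp.single t n)).subset ?_
  intro e he
  change Finsupp.weight RTree.weight e = n at he
  change e ≤ _
  intro t
  by_cases h0 : e t = 0
  · rw [h0]
    exact Nat.zero_le _
  · have h1 : e t * t.weight ≤ n := by
      have hs := Finset.single_le_sum (f := fun a => e a • RTree.weight a) (s := e.support)
        (fun _ _ => Nat.zero_le _) (Finsupp.mem_support_iff.2 h0)
      rw [Finsupp.weight_apply, Finsupp.sum] at he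
      rw [← he]
      simpa using hs
    have hp := t.weight_pos
    have ht : t ∈ h.toFinset := by
      rw [Set.Finite.mem_toFinset]
      change t.weight ≤ n
      nlinarith [Nat.pos_of_ne_zero h0]
    rw [Finsupp.finsetSum_apply]
    refine le_trans ?_ (Finset.single_le_sum (fun _ _ => Nat.zero_le _) ht)
    rw [Finsupp.single_eq_same]
    nlinarith

/-! ### Systems of Dyson-Schwinger equations -/

/-- The completion of the graded algebra of decorated rooted trees, for a finite set of
decorations: as there are finitely many forests of each weight, it is the algebra of all formal
(infinite) combinations of forests. -/
abbrev Completion (K I : Type*) [Field K] : Type _ := MvPowerSeries (RTree I) K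

open Classical in
/-- The grafting operator `B_i^+` on the completion: the coefficient of a forest `e` in
`B_i^+(x)` is the coefficient in `x` of the forest of the children of `t` if `e` is reduced to a
single tree `t` with root decorated by `i`, and is `0` otherwise. -/
noncomputable def graft {K I : Type*} [Field K] (i : I) (x : Completion K I) : Completion K I :=
  fun e => ∑ t ∈ e.support,
    if e = Finsupp.single t 1 ∧ t.root = i then
      MvPowerSeries.coeff (Multiset.toFinsupp t.children) x else 0

open Classical in
theorem coeff_graft {K I : Type*} [Field K] (i : I) (x : Completion K I) (e : RTree I →₀ ℕ) :
    MvPowerSeries.coeff e (graft i x) = ∑ t ∈ e.support,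
      if e = Finsupp.single t 1 ∧ t.root = i then
        MvPowerSeries.coeff (Multiset.toFinsupp t.children) x else 0 := rfl

/-- The system of Dyson-Schwinger equations `X_i = B_i^+(F_i(X_j, j ∈ I))`. -/
def IsSolution {K I : Type*} [Field K] (F : I → MvPowerSeries I K)
    (X : I → Completion K I) : Prop :=
  ∀ i, X i = graft i (MvPowerSeries.subst X (F i))

/-- Two elements of the completion agree in all degrees `< n`. -/
def Agree {K I : Type*} [Field K] (n : ℕ) (x y : Completion K I) : Prop :=
  ∀ e, forestWeight e < n → MvPowerSeries.coeff e x = MvPowerSeries.coeff e y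

theorem Agree.mul {K I : Type*} [Field K] {n : ℕ} {x y z w : Completion K I}
    (h : Agree n x y) (h' : Agree n z w) : Agree n (x * z) (y * w) := by
  classical
  intro e he
  rw [MvPowerSeries.coeff_mul, MvPowerSeries.coeff_mul]
  refine Finset.sum_congr rfl fun p hp => ?_
  replace hp := Finset.HasAntidiagonal.mem_antidiagonal.1 hp
  have hw : forestWeight p.1 + forestWeight p.2 = forestWeight e := by
    rw [← hp]
    exact (map_add (Finsupp.weight RTree.weight) p.1 p.2).symm
  rw [h p.1 (by omega), h' p.2 (by omega)]

theorem Agree.pow {K I : Type*} [Field K] {n : ℕ} {x y : Completion K I}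
    (h : Agree n x y) (k : ℕ) : Agree n (x ^ k) (y ^ k) := by
  induction k with
  | zero => exact fun e _ => by simp
  | succ k ih =>
    rw [pow_succ, pow_succ]
    exact ih.mul h

theorem Agree.subst {K I : Type*} [Field K] [Finite I] {n : ℕ} {X Y : I → Completion K I}
    (hX : ∀ i, MvPowerSeries.constantCoeff (X i) = 0)
    (hY : ∀ i, MvPowerSeries.constantCoeff (Y i) = 0)
    (h : ∀ i, Agree n (X i) (Y i)) (f : MvPowerSeries I K) :
    Agree n (MvPowerSeries.subst X f) (MvPowerSeries.subst Y f) := by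
  intro e he
  rw [MvPowerSeries.coeff_subst (MvPowerSeries.hasSubst_of_constantCoeff_zero hX),
    MvPowerSeries.coeff_subst (MvPowerSeries.hasSubst_of_constantCoeff_zero hY)]
  refine finsum_congr fun d => ?_
  congr 1
  have key : Agree n (d.prod fun s k => X s ^ k) (d.prod fun s k => Y s ^ k) := by
    rw [Finsupp.prod, Finsupp.prod]
    induction d.support using Finset.cons_induction with
    | empty => exact fun e _ => by simp
    | cons a s ha ih =>
      rw [Finset.prod_cons, Finset.prod_cons]
      exact ((h a).pow _).mul ih
  exact key e he

theorem constantCoeff_graft {K I : Type*} [Field K] (i : I) (x : Completion K I) :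
    MvPowerSeries.constantCoeff (graft i x) = 0 := by
  rw [← MvPowerSeries.coeff_zero_eq_constantCoeff_apply]
  classical
  rw [coeff_graft, Finsupp.support_zero, Finset.sum_empty]

theorem Agree.graft {K I : Type*} [Field K] {n : ℕ} {x y : Completion K I} (i : I)
    (h : Agree n x y) : Agree (n + 1) (DSE.graft i x) (DSE.graft i y) := by
  classical
  intro e he
  rw [coeff_graft, coeff_graft]
  refine Finset.sum_congr rfl fun t _ => ?_
  split_ifs with ht
  · apply h
    have h1 : forestWeight e = t.weight := by
      rw [ht.1, forestWeight, Finsupp.weight_single]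
      simp
    have h2 : t.weight = 1 + (t.children.map RTree.weight).sum := by
      conv_lhs => rw [← RTree.node_root_children t, RTree.weight_node]
    have h3 : forestWeight (Multiset.toFinsupp t.children)
        = (t.children.map RTree.weight).sum := by
      rw [forestWeight]
      induction t.children using Multiset.induction with
      | empty => simp
      | cons a s ih =>
        rw [← Multiset.singleton_add, map_add, map_add, ih, Multiset.toFinsupp_singleton,
          Finsupp.weight_single]
        simp
    omega
  · rfl

theorem existsUnique_solution {K I : Type*} [Field K] [Finite I] (F : I → MvPowerSeries I K) :
    ∃! X : I → Completion K I, IsSolution F X := by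
  let Φ : (I → Completion K I) → (I → Completion K I) :=
    fun X i => graft i (MvPowerSeries.subst X (F i))
  have hΦ0 : ∀ X i, MvPowerSeries.constantCoeff (Φ X i) = 0 := fun X i => constantCoeff_graft i _
  have step : ∀ (n : ℕ) (X Y : I → Completion K I),
      (∀ i, MvPowerSeries.constantCoeff (X i) = 0) →
      (∀ i, MvPowerSeries.constantCoeff (Y i) = 0) →
      (∀ i, Agree n (X i) (Y i)) → ∀ i, Agree (n + 1) (Φ X i) (Φ Y i) :=
    fun n X Y hX hY h i => (Agree.subst hX hY h (F i)).graft i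
  let A : ℕ → I → Completion K I := fun n => Φ^[n] 0
  have hA : ∀ n, A (n + 1) = Φ (A n) := fun n => Function.iterate_succ_apply' Φ n 0
  have hA0 : ∀ n i, MvPowerSeries.constantCoeff (A n i) = 0 := by
    intro n i
    cases n with
    | zero => exact map_zero _
    | succ n =>
      rw [hA]
      exact hΦ0 _ i
  have hA1 : ∀ n i, Agree n (A n i) (A (n + 1) i) := by
    intro n
    induction n with
    | zero => exact fun i e he => absurd he (Nat.not_lt_zero _)
    | succ n ih =>
      rw [hA n, hA (n + 1)]
      exact step n _ _ (hA0 n) (hA0 (n + 1)) ih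
  have hA2 : ∀ n k i, Agree n (A n i) (A (n + k) i) := by
    intro n k i
    induction k with
    | zero => exact fun e _ => rfl
    | succ k ih => exact fun e he => (ih e he).trans (hA1 (n + k) i e (by omega))
  let X : I → Completion K I :=
    fun i e => MvPowerSeries.coeff e (A (forestWeight e + 1) i)
  have hXA : ∀ n i, Agree n (X i) (A n i) := by
    intro n i e he
    obtain ⟨k, rfl⟩ : ∃ k, n = forestWeight e + 1 + k := ⟨n - (forestWeight e + 1), by omega⟩
    exact hA2 (forestWeight e + 1) k i e (Nat.lt_succ_self _)
  have hX0 : ∀ i, MvPowerSeries.constantCoeff (X i) = 0 := by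
    intro i
    rw [← MvPowerSeries.coeff_zero_eq_constantCoeff_apply,
      hXA 1 i 0 (by simp [forestWeight]), MvPowerSeries.coeff_zero_eq_constantCoeff_apply]
    exact hA0 1 i
  refine ⟨X, ?_, ?_⟩
  · intro i
    ext e
    have h1 := hXA (forestWeight e + 1) i e (Nat.lt_succ_self _)
    have h2 := step (forestWeight e) X (A (forestWeight e)) hX0 (hA0 _) (hXA _) i e
      (Nat.lt_succ_self _)
    rw [h1, hA]
    exact h2.symm
  · intro Y hY
    have hY0 : ∀ i, MvPowerSeries.constantCoeff (Y i) = 0 := by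
      intro i
      rw [hY i]
      exact constantCoeff_graft i _
    have hYX : ∀ n i, Agree n (Y i) (A n i) := by
      intro n
      induction n with
      | zero => exact fun i e he => absurd he (Nat.not_lt_zero _)
      | succ n ih =>
        intro i
        rw [hY i, hA]
        exact step n Y (A n) hY0 (hA0 n) ih i
    funext i
    ext e
    exact (hYX (forestWeight e + 1) i e (Nat.lt_succ_self _)).trans
      (hXA (forestWeight e + 1) i e (Nat.lt_succ_self _)).symm

/-- The unique solution of the system. -/
noncomputable def solution {K I : Type*} [Field K] [Finite I] (F : I → MvPowerSeries I K) :
    I → Completion K I :=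
  (existsUnique_solution F).choose

theorem solution_isSolution {K I : Type*} [Field K] [Finite I] (F : I → MvPowerSeries I K) :
    IsSolution F (solution F) :=
  (existsUnique_solution F).choose_spec.1

/-- The homogeneous component of degree `n` of an element of the completion. -/
noncomputable def homogPart {K I : Type*} [Field K] [Finite I] (n : ℕ) (x : Completion K I) :
    HopfTree K I :=
  ∑ e ∈ (finite_forestWeight_eq I n).toFinset,
    MvPolynomial.monomial e (MvPowerSeries.coeff e x)

/-- The homogeneous component `X_i(n)` of the solution. -/
noncomputable def comp {K I : Type*} [Field K] [Finite I] (F : I → MvPowerSeries I K)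
    (i : I) (n : ℕ) : HopfTree K I :=
  homogPart n (solution F i)

/-- The subalgebra `H_(S)` generated by the homogeneous components of the solution. -/
noncomputable def HS {K I : Type*} [Field K] [Finite I] (F : I → MvPowerSeries I K) :
    Subalgebra K (HopfTree K I) :=
  Algebra.adjoin K {x | ∃ i n, x = comp F i n}

/-- The inclusion of `H_(S) ⊗ H_(S)` in the tensor square of the algebra of trees. -/
noncomputable def tensorIncl {K I : Type*} [Field K] [Finite I] (F : I → MvPowerSeries I K) :
    HS F ⊗[K] HS F →ₗ[K] HopfTree K I ⊗[K] HopfTree K I :=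
  TensorProduct.map (HS F).val.toLinearMap (HS F).val.toLinearMap

/-- The system is Hopf: `Δ(H_(S)) ⊆ H_(S) ⊗ H_(S)`.  (The algebra of trees is graded and connected
and `H_(S)` is generated by homogeneous elements, so `H_(S)` is then stable under the antipode.) -/
def IsHopf {K I : Type*} [Field K] [Finite I] (F : I → MvPowerSeries I K) : Prop :=
  ∀ x ∈ HS F, comul K I x ∈ LinearMap.range (tensorIncl F)

/-- The coefficient `a_t` of the tree `t` in `X_i`, where `i` is the decoration of its root. -/
noncomputable def treeCoeff {K I : Type*} [Field K] [Finite I] (F : I → MvPowerSeries I K)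
    (t : RTree I) : K :=
  MvPowerSeries.coeff (Finsupp.single t 1) (solution F t.root)

/-- The trees of weight at most `n`. -/
noncomputable def treesLE (I : Type*) [Finite I] (n : ℕ) : Finset (RTree I) :=
  (finite_weight_le I n).toFinset

open Classical in
/-- The finite set of the trees with root decorated by `i` and weight `n`. -/
noncomputable def trees {I : Type*} [Finite I] (i : I) (n : ℕ) : Finset (RTree I) :=
  {t ∈ treesLE I n | t.root = i ∧ t.weight = n}

/-- `lam i j n`, for `n ≥ 1`, are the structure coefficients `λ_n^{(i,j)}` of the system: for every
tree `s` with root decorated by `i` and weight `n`, the sum of `n_j(t, s) a_t` over the trees `t`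
of weight `n + 1` with root decorated by `i` is `λ_n^{(i,j)} a_s`, where `n_j(t, s)` is the number
of leaves of `t` decorated by `j` such that cutting this leaf gives `s`. -/
def IsStructureCoeff {K I : Type*} [Field K] [Finite I] (F : I → MvPowerSeries I K)
    (lam : I → I → ℕ+ → K) : Prop :=
  ∀ (i j : I) (n : ℕ+), ∀ s ∈ trees i (n : ℕ),
    ∑ t ∈ trees i ((n : ℕ) + 1), (RTree.cutNumber (RTree.dot j) s t : K) * treeCoeff F t
      = lam i j n * treeCoeff F s

/-! ### Graded duals, primitive elements -/

/-- The tensor product of two linear forms, as a linear form on the tensor product. -/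
noncomputable def tensorForm {K A : Type*} [Field K] [AddCommGroup A] [Module K A]
    (f g : A →ₗ[K] K) : A ⊗[K] A →ₗ[K] K :=
  LinearMap.mul' K K ∘ₗ TensorProduct.map f g

theorem tensorForm_add_left {K A : Type*} [Field K] [AddCommGroup A] [Module K A]
    (f f' g : A →ₗ[K] K) : tensorForm (f + f') g = tensorForm f g + tensorForm f' g := by
  simp only [tensorForm, TensorProduct.map_add_left, LinearMap.comp_add]

theorem tensorForm_add_right {K A : Type*} [Field K] [AddCommGroup A] [Module K A]
    (f g g' : A →ₗ[K] K) : tensorForm f (g + g') = tensorForm f g + tensorForm f g' := by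
  simp only [tensorForm, TensorProduct.map_add_right, LinearMap.comp_add]

theorem tensorForm_smul_left {K A : Type*} [Field K] [AddCommGroup A] [Module K A]
    (c : K) (f g : A →ₗ[K] K) : tensorForm (c • f) g = c • tensorForm f g := by
  simp only [tensorForm, TensorProduct.map_smul_left, LinearMap.comp_smul]

theorem tensorForm_smul_right {K A : Type*} [Field K] [AddCommGroup A] [Module K A]
    (c : K) (f g : A →ₗ[K] K) : tensorForm f (c • g) = c • tensorForm f g := by
  simp only [tensorForm, TensorProduct.map_smul_right, LinearMap.comp_smul]

/-- `Prim(A^*)` for a subalgebra `A` of the algebra of trees: the linear forms `f` on `A` that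
belong to the graded dual (`f` vanishes in all large degrees) and are primitive for the coproduct
of the graded dual, which is the transpose of the product of `A` and for which the counit `ε` of
`A` is the unit: `f ∘ m = f ⊗ ε + ε ⊗ f`. -/
noncomputable def PrimDual {K D : Type*} [Field K] (A : Subalgebra K (HopfTree K D)) :
    Submodule K (A →ₗ[K] K) where
  carrier := {f |
    (∃ N : ℕ, ∀ n, N ≤ n → ∀ x : A, IsHomog (x : HopfTree K D) n → f x = 0) ∧
    f ∘ₗ LinearMap.mul' K A =
      tensorForm f ((counit K D).comp A.val).toLinearMap +
        tensorForm ((counit K D).comp A.val).toLinearMap f}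
  zero_mem' := by
    refine ⟨⟨0, fun _ _ _ _ => rfl⟩, ?_⟩
    have h := tensorForm_smul_left (0 : K) (0 : A →ₗ[K] K) ((counit K D).comp A.val).toLinearMap
    have h' := tensorForm_smul_right (0 : K) ((counit K D).comp A.val).toLinearMap (0 : A →ₗ[K] K)
    simp only [zero_smul] at h h'
    rw [h, h']
    simp
  add_mem' := by
    rintro f g ⟨⟨N, hN⟩, hf⟩ ⟨⟨M, hM⟩, hg⟩
    refine ⟨⟨max N M, fun n hn x hx => ?_⟩, ?_⟩
    · rw [LinearMap.add_apply, hN n (le_trans (le_max_left _ _) hn) x hx,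
        hM n (le_trans (le_max_right _ _) hn) x hx, add_zero]
    · rw [LinearMap.add_comp, hf, hg, tensorForm_add_left, tensorForm_add_right]
      abel
  smul_mem' := by
    rintro c f ⟨⟨N, hN⟩, hf⟩
    refine ⟨⟨N, fun n hn x hx => ?_⟩, ?_⟩
    · rw [LinearMap.smul_apply, hN n hn x hx, smul_zero]
    · rw [LinearMap.smul_comp, hf, tensorForm_smul_left, tensorForm_smul_right, smul_add]

/-- `X_i(n)` as an element of `H_(S)`. -/
noncomputable def compS {K I : Type*} [Field K] [Finite I] (F : I → MvPowerSeries I K)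
    (i : I) (n : ℕ) : HS F :=
  ⟨comp F i n, Algebra.subset_adjoin ⟨i, n, rfl⟩⟩

theorem coeff_homogPart {K I : Type*} [Field K] [Finite I] (n : ℕ) (x : Completion K I)
    (e : RTree I →₀ ℕ) (h : MvPolynomial.coeff e (homogPart n x) ≠ 0) :
    MvPowerSeries.coeff e x ≠ 0 := by
  classical
  intro h0
  apply h
  rw [homogPart, MvPolynomial.coeff_sum]
  refine Finset.sum_eq_zero fun e' _ => ?_
  rw [MvPolynomial.coeff_monomial]
  split_ifs with he
  · rw [he, h0]
  · rfl

theorem comp_mem {K I : Type*} [Field K] [Finite I] (F : I → MvPowerSeries I K) (i : I) (n : ℕ) :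
    (comp F i n).IsHomogeneous 1 := by
  classical
  intro e he
  have h1 := coeff_homogPart n (solution F i) e he
  rw [solution_isSolution F i] at h1
  rw [coeff_graft] at h1
  obtain ⟨t, _, ht⟩ := Finset.exists_ne_zero_of_sum_ne_zero h1
  rw [ite_ne_right_iff] at ht
  rw [ht.1.1]
  simp [Finsupp.weight_single]

theorem treeProj_mem {K I : Type*} [Field K] [Finite I] (F : I → MvPowerSeries I K)
    (x : HopfTree K I) (hx : x ∈ HS F) : treeProj K I x ∈ HS F := by
  have hx' : x ∈ Submodule.span K
      (Submonoid.closure {x | ∃ i n, x = comp F i n} : Set (HopfTree K I)) := by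
    rw [← Algebra.adjoin_eq_span]
    exact hx
  induction hx' using Submodule.span_induction with
  | mem y hy =>
    have hyS : y ∈ HS F := by
      have : y ∈ Subalgebra.toSubmodule (HS F) := by
        rw [HS, Algebra.adjoin_eq_span]
        exact Submodule.subset_span hy
      exact this
    have hh : ∃ k, y.IsHomogeneous k := by
      induction hy using Submonoid.closure_induction with
      | mem z hz =>
        obtain ⟨i, n, rfl⟩ := hz
        exact ⟨1, comp_mem F i n⟩
      | one => exact ⟨0, MvPolynomial.isHomogeneous_one _ _⟩
      | mul z w hz hw h1 h2 =>
        have m1 : ∀ {u : HopfTree K I}, u ∈ Submonoid.closure {x | ∃ i n, x = comp F i n} →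
            u ∈ HS F := by
          intro u hu
          have : u ∈ Subalgebra.toSubmodule (HS F) := by
            rw [HS, Algebra.adjoin_eq_span]
            exact Submodule.subset_span hu
          exact this
        obtain ⟨a, ha⟩ := h1 (m1 hz) (m1 hz)
        obtain ⟨b, hb⟩ := h2 (m1 hw) (m1 hw)
        exact ⟨a + b, ha.mul hb⟩
    obtain ⟨k, hk⟩ := hh
    rw [treeProj, MvPolynomial.homogeneousComponent_of_mem hk]
    split_ifs
    · exact hyS
    · exact zero_mem _
  | zero =>
    rw [map_zero]
    exact zero_mem _
  | add y z hy hz h1 h2 =>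
    have m1 : ∀ {u : HopfTree K I}, u ∈ Submodule.span K
        (Submonoid.closure {x | ∃ i n, x = comp F i n} : Set (HopfTree K I)) → u ∈ HS F := by
      intro u hu
      rw [← Algebra.adjoin_eq_span] at hu
      exact hu
    rw [map_add]
    exact add_mem (h1 (m1 hy)) (h2 (m1 hz))
  | smul c y hy h1 =>
    have m1 : y ∈ HS F := by
      rw [← Algebra.adjoin_eq_span] at hy
      exact hy
    rw [map_smul]
    exact Subalgebra.smul_mem _ (h1 m1) c

/-- The projection on trees, restricted to `H_(S)`. -/
noncomputable def treeProjS {K I : Type*} [Field K] [Finite I] (F : I → MvPowerSeries I K) :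
    HS F →ₗ[K] HS F :=
  LinearMap.restrict (p := Subalgebra.toSubmodule (HS F)) (q := Subalgebra.toSubmodule (HS F))
    (treeProj K I) (fun x hx => treeProj_mem F x hx)

theorem tensorIncl_injective {K I : Type*} [Field K] [Finite I] (F : I → MvPowerSeries I K) :
    Function.Injective (tensorIncl F) :=
  TensorProduct.map_injective_of_flat_flat _ _ Subtype.val_injective Subtype.val_injective

/-- The coproduct of `H_(S)`, for a Hopf system. -/
noncomputable def comulS {K I : Type*} [Field K] [Finite I] {F : I → MvPowerSeries I K}
    (hS : IsHopf F) : HS F →ₗ[K] HS F ⊗[K] HS F :=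
  (LinearEquiv.ofInjective (tensorIncl F) (tensorIncl_injective F)).symm.toLinearMap ∘ₗ
    LinearMap.codRestrict (LinearMap.range (tensorIncl F))
      ((comul K I).toLinearMap ∘ₗ (HS F).val.toLinearMap) (fun x => hS x x.2)

theorem tensorIncl_comulS {K I : Type*} [Field K] [Finite I] {F : I → MvPowerSeries I K}
    (hS : IsHopf F) (x : HS F) : tensorIncl F (comulS hS x) = comul K I x := by
  have := LinearEquiv.apply_symm_apply
    (LinearEquiv.ofInjective (tensorIncl F) (tensorIncl_injective F))
    ⟨comul K I x, hS x x.2⟩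
  exact congrArg Subtype.val this

/-- The product of the dual of `H_(S)`, transpose of the coproduct: `(f g)(x) = (f ⊗ g)(Δ(x))`. -/
noncomputable def dualMul {K I : Type*} [Field K] [Finite I] {F : I → MvPowerSeries I K}
    (hS : IsHopf F) (f g : HS F →ₗ[K] K) : HS F →ₗ[K] K :=
  tensorForm f g ∘ₗ comulS hS

/-- The Lie algebra `g_(S) = Prim(H_(S)^*)`, as a vector space. -/
noncomputable abbrev gS {K I : Type*} [Field K] [Finite I] (F : I → MvPowerSeries I K) :
    Submodule K (HS F →ₗ[K] K) :=
  PrimDual (HS F)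

/-- `h` is the pre-Lie product `f ⋆ g` in `Prim(H_(S)^*)`: on the span of the `X_i(n)`, one has
`h(x) = (f ⊗ g) ∘ (π ⊗ π) ∘ Δ(x)`, where `π` is the projection on trees. -/
def IsPreLieProdS {K I : Type*} [Field K] [Finite I] {F : I → MvPowerSeries I K}
    (hS : IsHopf F) (f g h : gS F) : Prop :=
  ∀ x ∈ Submodule.span K (Set.range fun p : I × ℕ => compS F p.1 p.2),
    h.1 x = tensorForm f.1 g.1 (TensorProduct.map (treeProjS F) (treeProjS F) (comulS hS x))

/-- The linear form on the whole algebra of trees given by a linear form on the subalgebra `⊤`. -/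
noncomputable def topForm {K D : Type*} [Field K]
    (f : (⊤ : Subalgebra K (HopfTree K D)) →ₗ[K] K) : HopfTree K D →ₗ[K] K :=
  f ∘ₗ (Subalgebra.topEquiv (R := K) (A := HopfTree K D)).symm.toLinearMap

/-- `h` is the pre-Lie product `f ⋆ g` in `Prim(H_D^*)`, where `H_D` is the whole algebra of trees
(dual to the Grossman-Larson algebra): on every tree `t`, one has
`h(t) = (f ⊗ g) ∘ (π ⊗ π) ∘ Δ(t)`, where `π` is the projection on trees. -/
def IsPreLieProdTree {K D : Type*} [Field K]
    (f g h : PrimDual (⊤ : Subalgebra K (HopfTree K D))) : Prop :=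
  ∀ t : RTree D, topForm h.1 (MvPolynomial.X t) =
    tensorForm (topForm f.1) (topForm g.1)
      (TensorProduct.map (treeProj K D) (treeProj K D) (comul K D (MvPolynomial.X t)))

end DSE

namespace DSE

open MvPolynomial

section

variable {K D : Type*} [Field K]

/-! ### The grafting operator on polynomials in trees -/

-- Everything is done in the whole algebra of trees and then restricted to H_(S). For an
-- infinitesimal character f, the operator L_f = (f ⊗ id) ∘ Δ (`leftOp`) is a derivation, and since
-- B_d^+ is a cocycle, L_f(B_d^+ x) = f(B_d^+ x)·1 + B_d^+(L_f x). These two rules determine L_f by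
-- induction on trees. The product f ⋆ g is the infinitesimal character with value g(L_f t) on a
-- tree t. Induction on trees gives L_{f⋆g − g⋆f} = L_g L_f − L_f L_g (`leftOp_infMul_sub`), with no
-- recourse to coassociativity, and the pre-Lie identity follows.
--
-- Since Δ(X_i(n)) lies in H_(S) ⊗ H_(S), the restriction of f ⋆ g to H_(S) depends only on those of
-- f and g (`restrictInf_infStar_congr`). So ⋆ descends to g_(S) once every primitive element is
-- known to be a restriction. Write Z_s for the form "coefficient of s". If s has root i, weight k
-- and a_s ≠ 0, then Z_s/a_s restricts to the dual vector f_i(k), and these vectors form a basis.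
-- Such an s exists for all i and k: in a Hopf system over a field of characteristic zero each F_i
-- has a nonzero linear term (`exists_linear_coeff_ne_zero`), so some ladder of each weight has a
-- nonzero coefficient.
--
-- Being an infinitesimal character, Z_t sees only the part of an element of H_(S) that is linear in
-- the X_i(n). So the tree coefficients of L_f X_i(n) ∈ H_(S) are proportional to the a_t, root by
-- root and degree by degree; with f the coefficient of a single vertex j, this gives the λ. For the
-- multiplication table, Z_p/a_p and the coefficient of the single vertex with the root decoration
-- of p agree on all the X_k. Their difference f satisfies L_f X_i = B_i^+(∑_k ∂_k F_i(X) L_f X_k),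
-- and as B_i^+ raises degrees, L_f X_i = 0 (`coeff_leftOp_treeForm_eq`). Series are handled through
-- truncations, modulo terms of large degree.

theorem RTree.induction {P : RTree D → Prop}
    (h : ∀ d m, (∀ s ∈ m, P s) → P (RTree.node d m)) (t : RTree D) : P t := by
  induction hn : t.weight using Nat.strong_induction_on generalizing t with
  | _ n ih =>
    rw [← RTree.node_root_children t]
    refine h _ _ fun s hs => ih s.weight ?_ s rfl
    have h1 := RTree.weight_node t.root t.children
    rw [RTree.node_root_children] at h1
    have h2 : s.weight ≤ (t.children.map RTree.weight).sum :=
      Multiset.single_le_sum (fun _ _ => Nat.zero_le _) _ (Multiset.mem_map_of_mem _ hs)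
    omega

theorem monomial_eq_prod (e : RTree D →₀ ℕ) :
    (monomial e 1 : HopfTree K D) = ((Finsupp.toMultiset e).map X).prod := by
  rw [Finsupp.toMultiset_map, Finsupp.prod_toMultiset, monomial_eq, map_one, one_mul,
    Finsupp.prod_mapDomain_index (by simp) (by simp [pow_add])]

/-- Linear maps on the algebra of trees which agree on the forests are equal. -/
theorem forest_ext {M : Type*} [AddCommMonoid M] [Module K M] {f g : HopfTree K D →ₗ[K] M}
    (h : ∀ m : Multiset (RTree D), f (m.map X).prod = g (m.map X).prod) : f = g := by
  refine (basisMonomials (RTree D) K).ext fun e => ?_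
  simpa [monomial_eq_prod] using h (Finsupp.toMultiset e)

/-- The grafting operator `B_d^+`. -/
noncomputable def graftPoly (d : D) : HopfTree K D →ₗ[K] HopfTree K D :=
  (basisMonomials (RTree D) K).constr K fun e => X (RTree.node d (Finsupp.toMultiset e))

theorem graftPoly_monomial (d : D) (e : RTree D →₀ ℕ) :
    graftPoly d (monomial e 1 : HopfTree K D) = X (RTree.node d (Finsupp.toMultiset e)) := by
  have := (basisMonomials (RTree D) K).constr_basis K
    (fun e => (X (RTree.node d (Finsupp.toMultiset e)) : HopfTree K D)) e
  rwa [coe_basisMonomials] at this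

theorem prod_eq_monomial (m : Multiset (RTree D)) :
    ∃ e, Finsupp.toMultiset e = m ∧ ((m.map X).prod : HopfTree K D) = monomial e 1 := by
  classical
  refine ⟨Multiset.toFinsupp m, by simp, ?_⟩
  rw [monomial_eq_prod]
  simp

@[simp]
theorem graftPoly_prod (d : D) (m : Multiset (RTree D)) :
    graftPoly d ((m.map X).prod : HopfTree K D) = X (RTree.node d m) := by
  obtain ⟨e, rfl, h⟩ := prod_eq_monomial (K := K) m
  rw [h, graftPoly_monomial]

/-! ### The coproduct of a grafted forest -/

theorem cuts_mk (t : PTree D) : (RTree.mk t).cuts = t.cuts := rfl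

theorem comul_X (t : RTree D) :
    comul K D (X t) = X t ⊗ₜ[K] 1 +
      (t.cuts.map fun c => (c.1.map (X (R := K))).prod ⊗ₜ[K] X c.2).sum := by
  rw [comul, aeval_X]

/-- By multiplicativity of Δ: the choice `({t}, 0)` in `PTree.cutsList` is the term t ⊗ 1 of Δ(t),
and the other choices are its non-total cuts. -/
theorem comul_prod_list (l : List (PTree D)) :
    comul K D ((l.map fun t => X (RTree.mk t)).prod) =
      ((PTree.cutsList l).map fun c =>
        (c.1.map (X (R := K))).prod ⊗ₜ[K] ((c.2.map (X (R := K))).prod)).sum := by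
  induction l with
  | nil => simp [PTree.cutsList, Algebra.TensorProduct.one_def]
  | cons t l ih =>
    rw [List.map_cons, List.prod_cons, map_mul, ih, PTree.cutsList, Multiset.map_bind,
      Multiset.sum_bind, comul_X, cuts_mk]
    simp only [Multiset.map_map, Function.comp_def, Multiset.map_add, Multiset.prod_add,
      ← Algebra.TensorProduct.tmul_mul_tmul, Multiset.sum_map_mul_left, Multiset.map_cons,
      Multiset.sum_cons, Multiset.map_singleton, Multiset.prod_singleton, Multiset.map_zero,
      Multiset.prod_zero, Multiset.sum_map_mul_right]
    rw [add_mul]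

/-- The operators `B_d^+` are cocycles. -/
theorem comul_graftPoly (d : D) (x : HopfTree K D) :
    comul K D (graftPoly d x) =
      graftPoly d x ⊗ₜ[K] 1 + (graftPoly d).lTensor (HopfTree K D) (comul K D x) := by
  suffices h : (comul K D).toLinearMap ∘ₗ graftPoly d =
      (TensorProduct.mk K _ _).flip 1 ∘ₗ graftPoly d +
        (graftPoly d).lTensor (HopfTree K D) ∘ₗ (comul K D).toLinearMap from
    LinearMap.congr_fun h x
  refine forest_ext fun m => ?_
  -- Cuts are defined by recursion on plane trees, so plane representatives of the trees of the
  -- forest are chosen.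
  obtain ⟨l, rfl⟩ : ∃ l : List (PTree D), m = (l.map RTree.mk : List (RTree D)) :=
    ⟨m.toList.map RTree.out, by simp [Function.comp_def, RTree.mk_out]⟩
  have h1 := comul_prod_list (K := K) l
  have h2 : (Multiset.map (X (R := K)) (List.map RTree.mk l : List (RTree D))).prod
      = (l.map fun t => X (RTree.mk t)).prod := by
    simp [Function.comp_def]
  simp only [LinearMap.comp_apply, LinearMap.add_apply, AlgHom.toLinearMap_apply, graftPoly_prod,
    LinearMap.flip_apply, TensorProduct.mk_apply]
  rw [comul_X, h2, h1, map_multiset_sum, ← RTree.mk_node, cuts_mk, PTree.cuts]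
  simp [Multiset.map_map, Function.comp_def]

@[simp]
theorem counit_X (t : RTree D) : counit K D (X t) = 0 := by
  rw [counit, aeval_X]

theorem counit_eq (x : HopfTree K D) : counit K D x = constantCoeff x := by
  exact aeval_zero' x

@[simp]
theorem counit_graftPoly (d : D) (x : HopfTree K D) : counit K D (graftPoly d x) = 0 := by
  suffices h : (counit K D).toLinearMap ∘ₗ graftPoly d = 0 from LinearMap.congr_fun h x
  refine forest_ext fun m => ?_
  simp

/-! ### The operators `(f ⊗ id) ∘ Δ` -/

/-- The operator `(f ⊗ id) ∘ Δ` of the algebra of trees. -/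
noncomputable def leftOp (f : HopfTree K D →ₗ[K] K) : HopfTree K D →ₗ[K] HopfTree K D :=
  (TensorProduct.lid K (HopfTree K D)).toLinearMap ∘ₗ f.rTensor (HopfTree K D) ∘ₗ
    (comul K D).toLinearMap

theorem leftOp_apply (f : HopfTree K D →ₗ[K] K) (x : HopfTree K D) :
    leftOp f x = TensorProduct.lid K (HopfTree K D) (f.rTensor (HopfTree K D) (comul K D x)) := rfl

theorem leftOp_add (f g : HopfTree K D →ₗ[K] K) : leftOp (f + g) = leftOp f + leftOp g := by
  refine LinearMap.ext fun x => ?_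
  simp [leftOp, LinearMap.rTensor_add]

theorem leftOp_sub (f g : HopfTree K D →ₗ[K] K) : leftOp (f - g) = leftOp f - leftOp g := by
  refine LinearMap.ext fun x => ?_
  simp [leftOp, LinearMap.rTensor_sub]

theorem leftOp_smul (c : K) (f : HopfTree K D →ₗ[K] K) : leftOp (c • f) = c • leftOp f := by
  refine LinearMap.ext fun x => ?_
  simp [leftOp, LinearMap.rTensor_smul]

/-- The cocycle identity seen through f ⊗ id; the scalar term comes from B_d^+(x) ⊗ 1. Together with
the Leibniz rule `leftOp_mul`, this is the recursion behind the inductions on trees below. -/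
theorem leftOp_graftPoly (f : HopfTree K D →ₗ[K] K) (d : D) (x : HopfTree K D) :
    leftOp f (graftPoly d x) = f (graftPoly d x) • 1 + graftPoly d (leftOp f x) := by
  have key : ∀ z : HopfTree K D ⊗[K] HopfTree K D,
      TensorProduct.lid K _ (f.rTensor _ ((graftPoly d).lTensor _ z)) =
        graftPoly d (TensorProduct.lid K _ (f.rTensor _ z)) := by
    intro z
    induction z with
    | zero => simp
    | tmul a b => simp
    | add a b ha hb => simp only [map_add, ha, hb]
  rw [leftOp_apply, comul_graftPoly, map_add, map_add, key, ← leftOp_apply]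
  simp

theorem leftOp_counit (x : HopfTree K D) : leftOp (counit K D).toLinearMap x = x := by
  -- The same map seen as an algebra morphism, so that it suffices to compare it with the identity
  -- on trees.
  let Φ : HopfTree K D →ₐ[K] HopfTree K D :=
    (Algebra.TensorProduct.lid K (HopfTree K D)).toAlgHom.comp
      ((Algebra.TensorProduct.map (counit K D) (AlgHom.id K _)).comp (comul K D))
  have hΦ : ∀ y, leftOp (counit K D).toLinearMap y = Φ y := by
    intro y
    rfl
  suffices h : Φ = AlgHom.id K _ by rw [hΦ, h]; rfl
  refine MvPolynomial.algHom_ext fun t => ?_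
  induction t using RTree.induction with
  | h d m ih =>
    have hm : Φ (m.map X).prod = (m.map X).prod := by
      rw [map_multiset_prod, Multiset.map_map]
      exact congrArg Multiset.prod (Multiset.map_congr rfl ih)
    rw [← graftPoly_prod, ← hΦ, leftOp_graftPoly, hΦ, hm]
    simp only [AlgHom.toLinearMap_apply, counit_graftPoly, zero_smul, zero_add, AlgHom.id_apply]

/-! ### Infinitesimal characters -/

/-- The infinitesimal characters of the algebra of trees. -/
def IsInf (f : HopfTree K D →ₗ[K] K) : Prop :=
  ∀ x y, f (x * y) = f x * counit K D y + counit K D x * f y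

theorem IsInf.map_one {f : HopfTree K D →ₗ[K] K} (hf : IsInf f) : f 1 = 0 := by
  have := hf 1 1
  simpa using this

theorem IsInf.add {f g : HopfTree K D →ₗ[K] K} (hf : IsInf f) (hg : IsInf g) : IsInf (f + g) := by
  intro x y
  simp only [LinearMap.add_apply, hf x y, hg x y]
  ring

theorem IsInf.sub {f g : HopfTree K D →ₗ[K] K} (hf : IsInf f) (hg : IsInf g) : IsInf (f - g) := by
  intro x y
  simp only [LinearMap.sub_apply, hf x y, hg x y]
  ring

theorem IsInf.smul {f : HopfTree K D →ₗ[K] K} (c : K) (hf : IsInf f) : IsInf (c • f) := by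
  intro x y
  simp only [LinearMap.smul_apply, hf x y, smul_eq_mul]
  ring

theorem IsInf.prod_eq_zero {f : HopfTree K D →ₗ[K] K} (hf : IsInf f) {m : Multiset (RTree D)}
    (hm : m.card ≠ 1) : f (m.map X).prod = 0 := by
  induction m using Multiset.induction with
  | empty => simpa using hf.map_one
  | cons a m _ =>
    rw [Multiset.map_cons, Multiset.prod_cons, hf, counit_X, zero_mul, add_zero]
    induction m using Multiset.induction with
    | empty => simp at hm
    | cons b m _ => simp

theorem IsInf.ext {f g : HopfTree K D →ₗ[K] K} (hf : IsInf f) (hg : IsInf g)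
    (h : ∀ t, f (X t) = g (X t)) : f = g := by
  refine forest_ext fun m => ?_
  by_cases hm : m.card = 1
  · obtain ⟨t, rfl⟩ := Multiset.card_eq_one.1 hm
    simpa using h t
  · rw [hf.prod_eq_zero hm, hg.prod_eq_zero hm]

/-- Infinitesimal characters vanish on forests that are not trees, so the projections π in the
definition of ⋆ can be dropped. -/
theorem IsInf.treeProj {f : HopfTree K D →ₗ[K] K} (hf : IsInf f) (x : HopfTree K D) :
    f (treeProj K D x) = f x := by
  suffices h : f ∘ₗ DSE.treeProj K D = f from LinearMap.congr_fun h x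
  refine forest_ext fun m => ?_
  have hh : ((m.map X).prod : HopfTree K D).IsHomogeneous m.card := by
    induction m using Multiset.induction with
    | empty => simpa using isHomogeneous_one _ _
    | cons a m ih =>
      rw [Multiset.map_cons, Multiset.prod_cons, Multiset.card_cons, add_comm]
      exact (isHomogeneous_X K a).mul ih
  rw [LinearMap.comp_apply, DSE.treeProj, homogeneousComponent_of_mem hh]
  split_ifs with hm
  · rfl
  · rw [map_zero, hf.prod_eq_zero (Ne.symm hm)]

/-- The infinitesimal character with given values on the trees. -/
noncomputable def infChar (u : RTree D → K) : HopfTree K D →ₗ[K] K :=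
  (counit K D).toLinearMap ∘ₗ (mkDerivation K fun t => (C (u t) : HopfTree K D)).toLinearMap

@[simp]
theorem infChar_X (u : RTree D → K) (t : RTree D) : infChar u (X t) = u t := by
  simp [infChar, mkDerivation_X]

/-- A derivation followed by the counit: the Leibniz rule becomes the rule of infinitesimal
characters. -/
theorem isInf_infChar (u : RTree D → K) : IsInf (infChar u) := by
  intro x y
  simp only [infChar, LinearMap.comp_apply, Derivation.coeFn_coe, Derivation.leibniz,
    AlgHom.toLinearMap_apply, map_add, smul_eq_mul, map_mul]
  ring

/-- Δ is multiplicative and f splits products as f·ε + ε·f; the factor that meets ε is restored by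
(ε ⊗ id) ∘ Δ = id. -/
theorem leftOp_mul {f : HopfTree K D →ₗ[K] K} (hf : IsInf f) (x y : HopfTree K D) :
    leftOp f (x * y) = leftOp f x * y + x * leftOp f y := by
  have key : ∀ z w : HopfTree K D ⊗[K] HopfTree K D,
      TensorProduct.lid K _ (f.rTensor _ (z * w)) =
        TensorProduct.lid K _ (f.rTensor _ z) *
          TensorProduct.lid K _ ((counit K D).toLinearMap.rTensor _ w) +
        TensorProduct.lid K _ ((counit K D).toLinearMap.rTensor _ z) *
          TensorProduct.lid K _ (f.rTensor _ w) := by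
    intro z w
    induction z with
    | zero => simp
    | add a b ha hb =>
      simp only [map_add, add_mul, ha, hb]
      ring
    | tmul a b =>
      induction w with
      | zero => simp
      | add a b ha hb =>
        simp only [map_add, mul_add, ha, hb]
        ring
      | tmul c d =>
        simp only [Algebra.TensorProduct.tmul_mul_tmul, LinearMap.rTensor_tmul, hf a c,
          TensorProduct.lid_tmul, AlgHom.toLinearMap_apply, smul_eq_C_mul, map_add, map_mul]
        ring
  have h := key (comul K D x) (comul K D y)
  rw [← map_mul] at h
  have hx := leftOp_counit x
  have hy := leftOp_counit y
  rw [leftOp_apply] at hx hy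
  rw [hx, hy] at h
  exact h

/-- `(f ⊗ id) ∘ Δ` as a derivation. -/
noncomputable def leftDer {f : HopfTree K D →ₗ[K] K} (hf : IsInf f) :
    Derivation K (HopfTree K D) (HopfTree K D) :=
  Derivation.mk' (leftOp f) fun x y => by
    rw [leftOp_mul hf, smul_eq_mul, smul_eq_mul]
    ring

@[simp]
theorem leftDer_apply {f : HopfTree K D →ₗ[K] K} (hf : IsInf f) (x : HopfTree K D) :
    leftDer hf x = leftOp f x := rfl

theorem leftOp_one {f : HopfTree K D →ₗ[K] K} (hf : IsInf f) : leftOp f 1 = 0 :=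
  (leftDer hf).map_one_eq_zero

-- The pre-Lie product of infinitesimal characters.

theorem counit_leftOp {f : HopfTree K D →ₗ[K] K} (hf : IsInf f) (x : HopfTree K D) :
    counit K D (leftOp f x) = f x := by
  suffices h : (counit K D).toLinearMap ∘ₗ leftOp f = f from LinearMap.congr_fun h x
  refine IsInf.ext (fun x y => ?_) hf fun t => ?_
  · simp [leftOp_mul hf]
  · rw [← RTree.node_root_children t, ← graftPoly_prod, LinearMap.comp_apply, leftOp_graftPoly]
    simp only [AlgHom.toLinearMap_apply, map_add, map_smul, map_one, counit_graftPoly, smul_eq_mul,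
      mul_one, add_zero]

/-- The pre-Lie product of infinitesimal characters. -/
noncomputable def infMul (f g : HopfTree K D →ₗ[K] K) : HopfTree K D →ₗ[K] K :=
  infChar fun t => g (leftOp f (X t))

theorem isInf_infMul (f g : HopfTree K D →ₗ[K] K) : IsInf (infMul f g) := isInf_infChar _

@[simp]
theorem infMul_X (f g : HopfTree K D →ₗ[K] K) (t : RTree D) :
    infMul f g (X t) = g (leftOp f (X t)) := infChar_X _ _

/-- The defining formula of `infMul` extends by linearity to the span of the trees, which is where
B_d^+ takes its values; it does not extend to products. -/
theorem infMul_graftPoly (f : HopfTree K D →ₗ[K] K) {g : HopfTree K D →ₗ[K] K} (d : D)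
    (x : HopfTree K D) : infMul f g (graftPoly d x) = g (leftOp f (graftPoly d x)) := by
  suffices h : infMul f g ∘ₗ graftPoly d = g ∘ₗ leftOp f ∘ₗ graftPoly d from
    LinearMap.congr_fun h x
  refine forest_ext fun m => ?_
  simp

/-- On a product xy, g ∘ L_f fails to be an infinitesimal character by f(x)g(y) + g(x)f(y). This is
symmetric in f and g, so the commutator is an infinitesimal character and it suffices to compare on
trees. -/
theorem infMul_sub_infMul {f g : HopfTree K D →ₗ[K] K} (hf : IsInf f) (hg : IsInf g)
    (x : HopfTree K D) :
    infMul f g x - infMul g f x = g (leftOp f x) - f (leftOp g x) := by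
  suffices h : infMul f g - infMul g f = g ∘ₗ leftOp f - f ∘ₗ leftOp g from
    LinearMap.congr_fun h x
  refine IsInf.ext ((isInf_infMul f g).sub (isInf_infMul g f)) (fun x y => ?_) fun t => ?_
  · simp only [LinearMap.sub_apply, LinearMap.comp_apply, leftOp_mul hf, leftOp_mul hg, map_add,
      hf _ _, hg _ _, counit_leftOp hf, counit_leftOp hg]
    ring
  · simp

/-- Both sides are derivations, hence it is enough to compare them on trees. For B_d^+ of a forest,
they agree on the forest by induction, and the scalar terms of `leftOp_graftPoly` match by
definition of `infMul`. -/
theorem leftOp_infMul_sub {f g : HopfTree K D →ₗ[K] K} (hf : IsInf f) (hg : IsInf g) :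
    leftOp (infMul f g - infMul g f) = leftOp g ∘ₗ leftOp f - leftOp f ∘ₗ leftOp g := by
  have hk := (isInf_infMul f g).sub (isInf_infMul g f)
  have key : leftDer hk = ⁅leftDer hg, leftDer hf⁆ := by
    refine MvPolynomial.derivation_ext fun t => ?_
    induction t using RTree.induction with
    | h d m ih =>
      have hm : leftDer hk (m.map X).prod = ⁅leftDer hg, leftDer hf⁆ (m.map X).prod := by
        induction m using Multiset.induction with
        | empty => simp
        | cons a m ihm =>
          rw [Multiset.map_cons, Multiset.prod_cons, Derivation.leibniz, Derivation.leibniz,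
            ih a (Multiset.mem_cons_self _ _),
            ihm fun s hs => ih s (Multiset.mem_cons_of_mem hs)]
      rw [← graftPoly_prod]
      simp only [Derivation.commutator_apply, leftDer_apply] at hm ⊢
      rw [leftOp_graftPoly, hm, LinearMap.sub_apply, infMul_graftPoly, infMul_graftPoly,
        leftOp_graftPoly f, leftOp_graftPoly g]
      simp only [map_add, map_smul, leftOp_one hf, leftOp_one hg, leftOp_graftPoly, hf.map_one,
        hg.map_one, map_sub, smul_zero, zero_add]
      module
  exact LinearMap.ext fun x => congrArg (fun δ => δ x) key

theorem infMul_preLie {f g : HopfTree K D →ₗ[K] K} (hf : IsInf f) (hg : IsInf g)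
    (h : HopfTree K D →ₗ[K] K) :
    infMul (infMul f g) h - infMul f (infMul g h) =
      infMul (infMul g f) h - infMul g (infMul f h) := by
  -- L_f(t) is a scalar plus a combination of trees, so (g ⋆ h)(L_f t) = h(L_g L_f t), although g ⋆
  -- h and h ∘ L_g differ on products.
  have assoc : ∀ {f g : HopfTree K D →ₗ[K] K}, IsInf f → IsInf g → ∀ t,
      infMul g h (leftOp f (X t)) = h (leftOp g (leftOp f (X t))) := by
    intro f g _ hg t
    rw [← RTree.node_root_children t, ← graftPoly_prod, leftOp_graftPoly, map_add, map_add,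
      map_add, infMul_graftPoly, map_smul, map_smul, map_smul, (isInf_infMul g h).map_one,
      leftOp_one hg, map_zero]
  refine IsInf.ext ((isInf_infMul _ _).sub (isInf_infMul _ _))
    ((isInf_infMul _ _).sub (isInf_infMul _ _)) fun t => ?_
  have h1 := congrArg h (LinearMap.congr_fun (leftOp_infMul_sub hf hg) (X t))
  rw [leftOp_sub] at h1
  simp only [LinearMap.sub_apply, LinearMap.comp_apply, map_sub] at h1
  simp only [LinearMap.sub_apply, infMul_X, assoc hf hg, assoc hg hf]
  linear_combination h1

end

section

variable {K D : Type*} [Field K]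

/-! ### Weights -/

theorem forestWeight_add (e e' : RTree D →₀ ℕ) :
    forestWeight (e + e') = forestWeight e + forestWeight e' :=
  map_add (Finsupp.weight RTree.weight) e e'

@[simp]
theorem forestWeight_zero : forestWeight (0 : RTree D →₀ ℕ) = 0 :=
  map_zero (Finsupp.weight RTree.weight)

@[simp]
theorem forestWeight_single (t : RTree D) : forestWeight (Finsupp.single t 1) = t.weight := by
  rw [forestWeight, Finsupp.weight_single, one_smul]

theorem sum_weight_toMultiset (e : RTree D →₀ ℕ) :
    ((Finsupp.toMultiset e).map RTree.weight).sum = forestWeight e := by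
  induction e using Finsupp.induction_linear with
  | zero => simp
  | add e e' h h' => rw [map_add, Multiset.map_add, Multiset.sum_add, h, h', forestWeight_add]
  | single t n =>
    rw [Finsupp.toMultiset_single, forestWeight, Finsupp.weight_single, Multiset.map_nsmul,
      Multiset.sum_nsmul]
    simp

theorem weight_node_toMultiset (d : D) (e : RTree D →₀ ℕ) :
    (RTree.node d (Finsupp.toMultiset e)).weight = forestWeight e + 1 := by
  rw [RTree.weight_node, add_comm, sum_weight_toMultiset]

theorem linear_mem_of_monomial {M : Type*} [AddCommGroup M] [Module K M]
    (T : HopfTree K D →ₗ[K] M) (S : Submodule K M) (x : HopfTree K D)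
    (h : ∀ e, coeff e x ≠ 0 → T (monomial e 1) ∈ S) : T x ∈ S := by
  rw [x.as_sum, map_sum]
  refine Submodule.sum_mem _ fun e he => ?_
  rw [← mul_one (coeff e x), ← smul_eq_mul, ← smul_monomial, map_smul]
  exact S.smul_mem _ (h e (mem_support_iff.1 he))

/-- The relations between weights used below: equality and inequality. -/
structure IsWeightRel (r : ℤ → ℤ → Prop) : Prop where
  refl : ∀ a, r a a
  trans : ∀ {a b c}, r a b → r b c → r a c
  add : ∀ {a b c d}, r a b → r c d → r (a + c) (b + d)

theorem isWeightRel_eq : IsWeightRel (fun a b => a = b) :=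
  ⟨fun _ => rfl, Eq.trans, fun h h' => congrArg₂ _ h h'⟩

theorem isWeightRel_le : IsWeightRel (fun a b => a ≤ b) :=
  ⟨le_refl, le_trans, add_le_add⟩

/-- The combinations of the forests whose weight is in relation `r` with `n`. -/
noncomputable def weightSub (K : Type*) {D : Type*} [Field K] (r : ℤ → ℤ → Prop) (n : ℤ) :
    Submodule K (HopfTree K D) where
  carrier := {x | ∀ e, coeff e x ≠ 0 → r n (forestWeight e)}
  zero_mem' := by simp
  add_mem' := by
    intro x y hx hy e he
    by_cases h : coeff e x = 0
    · refine hy e ?_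
      rwa [coeff_add, h, zero_add] at he
    · exact hx e h
  smul_mem' := by
    intro c x hx e he
    refine hx e fun h => he ?_
    rw [coeff_smul, h, smul_zero]

theorem mem_weightSub {r : ℤ → ℤ → Prop} {n : ℤ} {x : HopfTree K D} :
    x ∈ weightSub K r n ↔ ∀ e, coeff e x ≠ 0 → r n (forestWeight e) := Iff.rfl

theorem monomial_mem_weightSub {r : ℤ → ℤ → Prop} {n : ℤ} {e : RTree D →₀ ℕ}
    (h : r n (forestWeight e)) (c : K) :
    monomial e c ∈ weightSub K r n := by
  classical
  intro e' he'
  rw [coeff_monomial] at he'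
  split_ifs at he' with h'
  · exact h' ▸ h
  · exact absurd rfl he'

theorem one_mem_weightSub {r : ℤ → ℤ → Prop} (hr : IsWeightRel r) :
    (1 : HopfTree K D) ∈ weightSub K r 0 :=
  monomial_mem_weightSub (by simpa using hr.refl 0) 1

theorem X_mem_weightSub {r : ℤ → ℤ → Prop} (hr : IsWeightRel r) (t : RTree D) :
    (X t : HopfTree K D) ∈ weightSub K r t.weight :=
  monomial_mem_weightSub (by simpa using hr.refl _) 1

theorem mul_mem_weightSub {r : ℤ → ℤ → Prop} (hr : IsWeightRel r) {a b : ℤ}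
    {x y : HopfTree K D} (hx : x ∈ weightSub K r a) (hy : y ∈ weightSub K r b) :
    x * y ∈ weightSub K r (a + b) := by
  classical
  intro e he
  rw [coeff_mul] at he
  obtain ⟨p, hp, h⟩ := Finset.exists_ne_zero_of_sum_ne_zero he
  rw [← Finset.HasAntidiagonal.mem_antidiagonal.1 hp, forestWeight_add, Nat.cast_add]
  exact hr.add (hx _ (left_ne_zero_of_mul h)) (hy _ (right_ne_zero_of_mul h))

theorem graftPoly_mem_weightSub {r : ℤ → ℤ → Prop} (hr : IsWeightRel r) (d : D) {n : ℤ}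
    {x : HopfTree K D} (hx : x ∈ weightSub K r n) :
    graftPoly d x ∈ weightSub K r (n + 1) := by
  refine linear_mem_of_monomial _ _ _ fun e he => ?_
  rw [graftPoly_monomial]
  refine monomial_mem_weightSub ?_ 1
  rw [forestWeight_single, weight_node_toMultiset, Nat.cast_add, Nat.cast_one]
  exact hr.add (hx e he) (hr.refl 1)

theorem prod_mem_weightSub {r : ℤ → ℤ → Prop} (hr : IsWeightRel r)
    (m : Multiset (RTree D)) :
    ((m.map X).prod : HopfTree K D) ∈ weightSub K r ((m.map RTree.weight).sum : ℕ) := by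
  induction m using Multiset.induction with
  | empty => simpa using one_mem_weightSub hr
  | cons a m ih =>
    simp only [Multiset.map_cons, Multiset.prod_cons, Multiset.sum_cons, Nat.cast_add]
    exact mul_mem_weightSub hr (X_mem_weightSub hr a) ih

/-- The only term of L_f(B_d^+ x) outside B_d^+(L_f x) is a scalar, of degree 0, which `hw`
controls. Degrees are integers because the weight minus w may be negative. -/
theorem leftOp_X_mem_weightSub {r : ℤ → ℤ → Prop} (hr : IsWeightRel r)
    {f : HopfTree K D →ₗ[K] K} (hf : IsInf f) {w : ℤ}
    (hw : ∀ t, f (X t) ≠ 0 → r (t.weight - w) 0) (t : RTree D) :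
    leftOp f (X t) ∈ weightSub K r (t.weight - w) := by
  induction t using RTree.induction with
  | h d m ih =>
    have hm : leftOp f (m.map X).prod ∈
        weightSub K r (((m.map RTree.weight).sum : ℕ) - w) := by
      induction m using Multiset.induction with
      | empty =>
        simp only [Multiset.map_zero, Multiset.prod_zero, leftOp_one hf]
        exact zero_mem _
      | cons a m ihm =>
        simp only [Multiset.map_cons, Multiset.prod_cons, leftOp_mul hf, Multiset.sum_cons,
          Nat.cast_add]
        refine add_mem ?_ ?_
        · rw [add_sub_right_comm]
          exact mul_mem_weightSub hr (ih a (Multiset.mem_cons_self _ _)) (prod_mem_weightSub hr m)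
        · rw [add_sub_assoc]
          exact mul_mem_weightSub hr (X_mem_weightSub hr a)
            (ihm fun s hs => ih s (Multiset.mem_cons_of_mem hs))
    rw [← graftPoly_prod, leftOp_graftPoly, graftPoly_prod]
    refine add_mem ?_ ?_
    · by_cases h : f (X (RTree.node d m)) = 0
      · rw [h, zero_smul]
        exact zero_mem _
      · refine Submodule.smul_mem _ _ (monomial_mem_weightSub ?_ 1)
        simpa using hw _ h
    · have := graftPoly_mem_weightSub hr d hm
      rw [RTree.weight_node]
      convert this using 2
      push_cast
      ring

theorem leftOp_mem_weightSub {r : ℤ → ℤ → Prop} (hr : IsWeightRel r)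
    {f : HopfTree K D →ₗ[K] K} (hf : IsInf f) {w : ℤ}
    (hw : ∀ t, f (X t) ≠ 0 → r (t.weight - w) 0) {n : ℤ} {x : HopfTree K D}
    (hx : x ∈ weightSub K r n) : leftOp f x ∈ weightSub K r (n - w) := by
  have hm : ∀ m : Multiset (RTree D), leftOp f (m.map X).prod ∈
      weightSub K r (((m.map RTree.weight).sum : ℕ) - w) := by
    intro m
    induction m using Multiset.induction with
    | empty =>
      simp only [Multiset.map_zero, Multiset.prod_zero, leftOp_one hf]
      exact zero_mem _
    | cons a m ihm =>
      simp only [Multiset.map_cons, Multiset.prod_cons, leftOp_mul hf, Multiset.sum_cons,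
        Nat.cast_add]
      refine add_mem ?_ ?_
      · rw [add_sub_right_comm]
        exact mul_mem_weightSub hr (leftOp_X_mem_weightSub hr hf hw a) (prod_mem_weightSub hr m)
      · rw [add_sub_assoc]
        exact mul_mem_weightSub hr (X_mem_weightSub hr a) ihm
  refine linear_mem_of_monomial _ _ _ fun e he e' he' => ?_
  rw [monomial_eq_prod] at he'
  refine hr.trans (hr.add (hx e he) (hr.refl (-w))) ?_
  have := hm _ e' he'
  rwa [sum_weight_toMultiset] at this

/-! ### Coefficients of trees -/

open Classical in
theorem coeff_graftPoly (d : D) (x : HopfTree K D) (e : RTree D →₀ ℕ) :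
    coeff e (graftPoly d x) = ∑ t ∈ e.support,
      if e = Finsupp.single t 1 ∧ t.root = d then
        coeff (Multiset.toFinsupp t.children) x else 0 := by
  suffices h : lcoeff K e ∘ₗ graftPoly d = ∑ t ∈ e.support,
      (if e = Finsupp.single t 1 ∧ t.root = d then (1 : K) else 0) •
        lcoeff K (Multiset.toFinsupp t.children) by
    have := LinearMap.congr_fun h x
    simpa only [LinearMap.comp_apply, lcoeff_apply, LinearMap.sum_apply, LinearMap.smul_apply,
      smul_eq_mul, ite_mul, one_mul, zero_mul] using this
  refine (basisMonomials (RTree D) K).ext fun e' => ?_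
  simp only [coe_basisMonomials, LinearMap.comp_apply, graftPoly_monomial, lcoeff_apply,
    LinearMap.sum_apply, LinearMap.smul_apply, coeff_monomial, coeff_X, smul_eq_mul]
  by_cases he : ∃ t, e = Finsupp.single t 1
  · obtain ⟨t, rfl⟩ := he
    rw [Finsupp.support_single _ one_ne_zero, Finset.sum_singleton]
    by_cases h : RTree.node d (Finsupp.toMultiset e') = t
    · subst h
      simp
    · rw [if_neg fun h' => h (Finsupp.single_left_injective one_ne_zero h')]
      split_ifs with h1 h2
      · obtain ⟨-, rfl⟩ := h1
        subst h2
        exact absurd (by simp) h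
      all_goals simp
  · rw [if_neg fun h => he ⟨_, h.symm⟩]
    exact (Finset.sum_eq_zero fun t _ => by rw [if_neg fun h => he ⟨t, h.1⟩, zero_mul]).symm

theorem coeff_single_graftPoly (d : D) (x : HopfTree K D) (e : RTree D →₀ ℕ) :
    coeff (Finsupp.single (RTree.node d (Finsupp.toMultiset e)) 1) (graftPoly d x) = coeff e x := by
  classical
  rw [coeff_graftPoly, Finsupp.support_single _ one_ne_zero, Finset.sum_singleton]
  simp

theorem coeff_single_graftPoly_of_ne {d : D} (x : HopfTree K D) {t : RTree D} (h : t.root ≠ d) :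
    coeff (Finsupp.single t 1) (graftPoly d x) = 0 := by
  classical
  rw [coeff_graftPoly]
  exact Finset.sum_eq_zero fun s _ => if_neg fun hs =>
    h (by rw [Finsupp.single_left_injective one_ne_zero hs.1, hs.2])

/-- The linear form giving the coefficient of a tree. -/
noncomputable def treeForm (K : Type*) {D : Type*} [Field K] (t : RTree D) :
    HopfTree K D →ₗ[K] K :=
  lcoeff K (Finsupp.single t 1)

@[simp]
theorem treeForm_apply (t : RTree D) (x : HopfTree K D) :
    treeForm K t x = coeff (Finsupp.single t 1) x := rfl

theorem isInf_treeForm (t : RTree D) : IsInf (treeForm K t) := by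
  classical
  intro x y
  simp only [treeForm_apply, coeff_mul, Finsupp.antidiagonal_single, counit_eq]
  rw [Finset.sum_map, Finset.Nat.antidiagonal_succ]
  simp [constantCoeff_eq]
  ring

open Classical in
-- Turns the numbers of cuts in the definition of the λ into coefficients of a derivation: the cuts
-- counted are those contributing p ⊗ s to Δ(t), while t ⊗ 1 contributes only a constant.
theorem coeff_leftOp_treeForm (p s t : RTree D) :
    coeff (Finsupp.single s 1) (leftOp (treeForm K p) (X t)) = RTree.cutNumber p s t := by
  have h1 : ∀ c : Multiset (RTree D) × RTree D,
      coeff (Finsupp.single s 1) (coeff (Finsupp.single p 1) (c.1.map (X (R := K))).prod •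
        (X c.2 : HopfTree K D)) = if c = ({p}, s) then 1 else 0 := by
    intro c
    obtain ⟨m, u⟩ := c
    obtain ⟨e, rfl, h⟩ := prod_eq_monomial (K := K) m
    have h2 : Finsupp.toMultiset e = {p} ↔ e = Finsupp.single p 1 :=
      ⟨fun h => by rw [← Finsupp.toMultiset_toFinsupp e, h, Multiset.toFinsupp_singleton],
        fun h => by simp [h]⟩
    simp only [h, coeff_smul, coeff_monomial, coeff_X, smul_eq_mul, Prod.mk.injEq, h2,
      (Finsupp.single_left_injective one_ne_zero).eq_iff, ← ite_and, mul_ite, mul_one, mul_zero]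
    split_ifs <;> simp_all
  rw [leftOp_apply, comul_X, RTree.cutNumber]
  simp only [map_add, LinearMap.rTensor_tmul, TensorProduct.lid_tmul, map_multiset_sum,
    Multiset.map_map, Function.comp_def, treeForm_apply]
  rw [← lcoeff_apply, map_add, map_multiset_sum, Multiset.map_map]
  simp only [Function.comp_def, lcoeff_apply, h1]
  rw [coeff_smul, coeff_one, if_neg (Finsupp.single_ne_zero.2 one_ne_zero).symm, smul_zero,
    zero_add]
  induction t.cuts using Multiset.induction with
  | empty => simp
  | cons c m ih =>
    rw [Multiset.map_cons, Multiset.sum_cons, ih, Multiset.count_cons]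
    by_cases h : c = ({p}, s)
    · subst h
      simp [add_comm]
    · rw [if_neg h, if_neg (Ne.symm h)]
      simp

end

section

variable {K I : Type*} [Field K]

/-! ### The solution of the system and its truncations -/

theorem constantCoeff_solution [Finite I] (F : I → MvPowerSeries I K) (i : I) :
    MvPowerSeries.constantCoeff (solution F i) = 0 := by
  rw [solution_isSolution F i]
  exact constantCoeff_graft i _

open Classical in
theorem coeff_comp [Finite I] (F : I → MvPowerSeries I K) (i : I) (n : ℕ) (e : RTree I →₀ ℕ) :
    coeff e (comp F i n) =
      if forestWeight e = n then MvPowerSeries.coeff e (solution F i) else 0 := by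
  rw [comp, homogPart, coeff_sum]
  simp only [coeff_monomial, Finset.sum_ite_eq', Set.Finite.mem_toFinset, Set.mem_ofPred_eq]

theorem exists_tree_of_coeff_solution [Finite I] (F : I → MvPowerSeries I K) (i : I) {e : RTree I →₀ ℕ}
    (h : MvPowerSeries.coeff e (solution F i) ≠ 0) :
    ∃ t : RTree I, e = Finsupp.single t 1 ∧ t.root = i := by
  classical
  rw [solution_isSolution F i, coeff_graft] at h
  obtain ⟨t, _, ht⟩ := Finset.exists_ne_zero_of_sum_ne_zero h
  rw [ite_ne_right_iff] at ht
  exact ⟨t, ht.1⟩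

open Classical in
theorem coeff_single_comp [Finite I] (F : I → MvPowerSeries I K) (i : I) (n : ℕ) (t : RTree I) :
    coeff (Finsupp.single t 1) (comp F i n) =
      if t.root = i ∧ t.weight = n then treeCoeff F t else 0 := by
  rw [coeff_comp, forestWeight_single]
  by_cases hi : t.root = i
  · subst hi
    simp [treeCoeff]
  · rw [if_neg (c := t.root = i ∧ t.weight = n) fun h => hi h.1]
    split_ifs
    · by_contra h
      obtain ⟨s, hs, hs'⟩ := exists_tree_of_coeff_solution F i h
      exact hi (by rw [Finsupp.single_left_injective one_ne_zero hs, hs'])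
    · rfl

theorem mem_trees [Finite I] {i : I} {n : ℕ} {t : RTree I} : t ∈ trees i n ↔ t.root = i ∧ t.weight = n := by
  classical
  rw [trees, Finset.mem_filter, treesLE, Set.Finite.mem_toFinset, Set.mem_ofPred_eq]
  exact ⟨fun h => h.2, fun h => ⟨h.2.le, h⟩⟩

theorem comp_eq_sum [Finite I] (F : I → MvPowerSeries I K) (i : I) (n : ℕ) :
    comp F i n = ∑ t ∈ trees i n, treeCoeff F t • (X t : HopfTree K I) := by
  classical
  ext e
  simp only [coeff_sum, coeff_smul, coeff_X, smul_eq_mul, mul_ite, mul_one, mul_zero]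
  by_cases he : ∃ t, e = Finsupp.single t 1
  · obtain ⟨t, rfl⟩ := he
    simp only [(Finsupp.single_left_injective one_ne_zero).eq_iff, Finset.sum_ite_eq',
      mem_trees]
    exact coeff_single_comp F i n t
  · rw [coeff_comp, Finset.sum_eq_zero fun t _ => if_neg fun h => he ⟨t, h.symm⟩]
    split_ifs
    · by_contra h
      obtain ⟨t, ht, -⟩ := exists_tree_of_coeff_solution F i h
      exact he ⟨t, ht⟩
    · rfl

/-- The part of degree at most `N` of the solution. -/
noncomputable def trunc [Finite I] (F : I → MvPowerSeries I K) (N : ℕ) (i : I) : HopfTree K I :=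
  ∑ n ∈ Finset.range (N + 1), comp F i n

theorem coeff_trunc [Finite I] (F : I → MvPowerSeries I K) (N : ℕ) (i : I) (e : RTree I →₀ ℕ) :
    coeff e (trunc F N i) =
      if forestWeight e ≤ N then MvPowerSeries.coeff e (solution F i) else 0 := by
  classical
  rw [trunc, coeff_sum]
  simp only [coeff_comp, Finset.sum_ite_eq, Finset.mem_range, Nat.lt_succ_iff]

theorem coe_graftPoly (i : I) (x : HopfTree K I) :
    ((graftPoly i x : HopfTree K I) : Completion K I) = graft i (x : Completion K I) := by
  classical
  ext e
  rw [coeff_graft, coeff_coe, coeff_graftPoly]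
  rfl

theorem finite_forestWeight_le [Finite I] (N : ℕ) : {e : RTree I →₀ ℕ | forestWeight e ≤ N}.Finite := by
  refine (Set.Finite.biUnion (Set.finite_Iic N) fun n _ => finite_forestWeight_eq I n).subset ?_
  intro e he
  simpa using he

/-- In degrees at most `N`, the system holds with the truncated solution and with suitable partial
sums of the series `F_i`. -/
theorem exists_trunc [Finite I] (F : I → MvPowerSeries I K) (N : ℕ) (d₀ : I →₀ ℕ) :
    ∃ P : I → MvPolynomial I K,
      (∀ i d, coeff d (P i) = MvPowerSeries.coeff d (F i) ∨ coeff d (P i) = 0) ∧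
      (∀ i, coeff d₀ (P i) = MvPowerSeries.coeff d₀ (F i)) ∧
      ∀ i, trunc F N i - graftPoly i (aeval (trunc F N) (P i)) ∈
        weightSub K (fun a b => a ≤ b) ((N : ℤ) + 1) := by
  classical
  let Y : I → Completion K I := fun i => (trunc F N i : Completion K I)
  have hY0 : ∀ i, MvPowerSeries.constantCoeff (Y i) = 0 := by
    intro i
    rw [← MvPowerSeries.coeff_zero_eq_constantCoeff_apply, coeff_coe, coeff_trunc]
    simp [constantCoeff_solution]
  have hYs : MvPowerSeries.HasSubst Y := MvPowerSeries.hasSubst_of_constantCoeff_zero hY0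
  have hYX : ∀ i, Agree (N + 1) (solution F i) (Y i) := by
    intro i e he
    rw [coeff_coe, coeff_trunc, if_pos (by omega)]
  -- The finitely many exponents that contribute in degrees at most N; d₀ is added so that one
  -- prescribed coefficient of each F_i survives.
  let S : I → Finset (I →₀ ℕ) := fun i =>
    insert d₀ ((finite_forestWeight_le N).toFinset.biUnion fun e =>
      (MvPowerSeries.coeff_subst_finite hYs (F i) e).toFinset)
  let P : I → MvPolynomial I K := fun i =>
    ∑ d ∈ S i, monomial d (MvPowerSeries.coeff d (F i))
  have hP : ∀ i d, coeff d (P i) = if d ∈ S i then MvPowerSeries.coeff d (F i) else 0 := by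
    intro i d
    simp only [P, coeff_sum, coeff_monomial, Finset.sum_ite_eq']
  refine ⟨P, fun i d => ?_, fun i => ?_, fun i => ?_⟩
  · rw [hP]
    split_ifs <;> simp
  · rw [hP, if_pos (Finset.mem_insert_self _ _)]
  · have h1 : Agree (N + 1) (MvPowerSeries.subst Y (F i))
        ((aeval (trunc F N) (P i) : HopfTree K I) : Completion K I) := by
      intro e he
      rw [MvPowerSeries.coeff_subst hYs, finsum_eq_sum_of_support_subset (s := S i)]
      · simp only [coeff_coe, P, map_sum, aeval_monomial, coeff_sum]
        refine Finset.sum_congr rfl fun d _ => ?_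
        have : (d.prod fun s k => Y s ^ k) =
            ((d.prod fun s k => trunc F N s ^ k : HopfTree K I) : Completion K I) := by
          simp only [Finsupp.prod, Y]
          rw [← coeToMvPowerSeries.ringHom_apply, map_prod]
          simp
        rw [this, coeff_coe, smul_eq_mul, algebraMap_eq, coeff_C_mul]
      · intro d hd
        simp only [S, Finset.coe_insert, Set.mem_insert_iff, Finset.mem_coe, Finset.mem_biUnion,
          Set.Finite.mem_toFinset]
        exact Or.inr ⟨e, Nat.lt_succ_iff.1 he, Set.Finite.mem_toFinset _ |>.2 hd⟩
    have h2 := (Agree.subst (constantCoeff_solution F) hY0 hYX (F i)).graft i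
    have h3 := h1.graft i
    rw [← solution_isSolution F i] at h2
    rw [← coe_graftPoly] at h3
    intro e he
    by_contra hlt
    have hlt' : forestWeight e < N + 1 := by omega
    apply he
    rw [coeff_sub, coeff_trunc, if_pos (by omega), h2 e (by omega), h3 e (by omega), coeff_coe,
      sub_self]

/-! ### The chain rule -/

theorem derivation_aeval {A : Type*} [CommRing A] [Algebra K A] (δ : Derivation K A A)
    [Fintype I] (Y : I → A) (P : MvPolynomial I K) :
    δ (aeval Y P) = ∑ k, aeval Y (pderiv k P) * δ (Y k) := by
  classical
  induction P using MvPolynomial.induction_on with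
  | C c => simp
  | add p q hp hq => simp [hp, hq, add_mul, Finset.sum_add_distrib]
  | mul_X p i hp =>
    simp only [map_mul, aeval_X, Derivation.leibniz, smul_eq_mul, hp, map_add, pderiv_X, add_mul,
      Finset.sum_add_distrib]
    congr 1
    · rw [Finset.sum_eq_single i]
      · simp
      · intro j _ hj
        simp [hj.symm]
      · simp
    · rw [Finset.mul_sum]
      refine Finset.sum_congr rfl fun k _ => ?_
      ring

end

section

variable {K I : Type*} [Field K]

/-! ### Consequences of the truncated system -/

theorem coeff_eq_of_sub_mem {x y : HopfTree K I} {n : ℤ}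
    (h : x - y ∈ weightSub K (fun a b => a ≤ b) n) {e : RTree I →₀ ℕ} (he : forestWeight e < n) :
    coeff e x = coeff e y := by
  by_contra hne
  have := h e (by rwa [coeff_sub, sub_ne_zero])
  omega

theorem mem_weightSub_le_zero (x : HopfTree K I) : x ∈ weightSub K (fun a b => a ≤ b) 0 :=
  fun _ _ => Int.natCast_nonneg _

/-- An infinitesimal character which vanishes on the trees of large weight vanishes in all large
degrees. -/
theorem IsInf.eq_zero_of_mem {f : HopfTree K I →ₗ[K] K} (hf : IsInf f) {n : ℤ}
    (hn : ∀ t : RTree I, n ≤ t.weight → f (X t) = 0) {x : HopfTree K I}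
    (hx : x ∈ weightSub K (fun a b => a ≤ b) n) : f x = 0 := by
  refine (Submodule.mem_bot K).1 (linear_mem_of_monomial f ⊥ _ fun e he => ?_)
  rw [Submodule.mem_bot, monomial_eq_prod]
  by_cases hc : (Finsupp.toMultiset e).card = 1
  · obtain ⟨t, ht⟩ := Multiset.card_eq_one.1 hc
    have h := hx e he
    rw [← sum_weight_toMultiset, ht, Multiset.map_singleton, Multiset.sum_singleton] at h
    rw [ht, Multiset.map_singleton, Multiset.prod_singleton]
    exact hn t h
  · exact hf.prod_eq_zero hc

theorem weightSub_le_anti {m n : ℤ} (h : m ≤ n) :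
    (weightSub K (fun a b => a ≤ b) n : Submodule K (HopfTree K I)) ≤
      weightSub K (fun a b => a ≤ b) m :=
  fun _ hx e he => h.trans (hx e he)

theorem treeForm_X_ne_zero {s t : RTree I} (h : treeForm K s (X t) ≠ 0) : t = s := by
  classical
  rw [treeForm_apply, coeff_X] at h
  by_contra hne
  exact h (if_neg fun h' => hne (Finsupp.single_left_injective one_ne_zero h'))

section

variable [Finite I]

theorem counit_trunc (F : I → MvPowerSeries I K) (N : ℕ) (i : I) :
    counit K I (trunc F N i) = 0 := by
  rw [counit_eq, constantCoeff_eq, coeff_trunc]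
  simp [constantCoeff_solution]

theorem counit_aeval_trunc (F : I → MvPowerSeries I K) (N : ℕ) (P : MvPolynomial I K) :
    counit K I (aeval (trunc F N) P) = constantCoeff P := by
  rw [← AlgHom.comp_apply, comp_aeval]
  simp only [counit_trunc]
  exact aeval_zero' P

theorem coeff_trunc_single (F : I → MvPowerSeries I K) (N : ℕ) (t : RTree I)
    (h : t.weight ≤ N) : coeff (Finsupp.single t 1) (trunc F N t.root) = treeCoeff F t := by
  rw [coeff_trunc, forestWeight_single, if_pos h, treeCoeff]

theorem coeff_trunc_single_of_ne (F : I → MvPowerSeries I K) (N : ℕ) {t : RTree I} {i : I}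
    (h : t.root ≠ i) : coeff (Finsupp.single t 1) (trunc F N i) = 0 := by
  classical
  rw [trunc, coeff_sum]
  exact Finset.sum_eq_zero fun n _ => by rw [coeff_single_comp, if_neg fun h' => h h'.1]

variable {F : I → MvPowerSeries I K} {N : ℕ} {P : I → MvPolynomial I K}

theorem treeCoeff_node (hP : ∀ i, trunc F N i - graftPoly i (aeval (trunc F N) (P i)) ∈
      weightSub K (fun a b => a ≤ b) ((N : ℤ) + 1)) (i : I) (e : RTree I →₀ ℕ)
    (he : forestWeight e < N) :
    treeCoeff F (RTree.node i (Finsupp.toMultiset e)) = coeff e (aeval (trunc F N) (P i)) := by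
  have hw := weight_node_toMultiset i e
  rw [← coeff_single_graftPoly i, ← coeff_eq_of_sub_mem (hP i) (by
    rw [forestWeight_single]; omega), ← coeff_trunc_single F N _ (by omega), RTree.root_node]

theorem treeCoeff_dot (F : I → MvPowerSeries I K)
    (hF1 : ∀ i, MvPowerSeries.constantCoeff (F i) = 1) (i : I) :
    treeCoeff F (RTree.dot i) = 1 := by
  obtain ⟨P, -, hP0, hP⟩ := exists_trunc F 1 0
  have h := treeCoeff_node hP i 0 (by simp)
  rw [map_zero] at h
  rw [RTree.dot, h, ← constantCoeff_eq, ← counit_eq, counit_aeval_trunc, constantCoeff_eq, hP0,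
    MvPowerSeries.coeff_zero_eq_constantCoeff_apply, hF1]

/-- Z_t is an infinitesimal character and the X_k have no constant term, so by the chain rule only
the linear terms of F_i contribute to the coefficient of t in F_i(X). -/
theorem treeCoeff_node_singleton (F : I → MvPowerSeries I K) (i : I) (t : RTree I) :
    treeCoeff F (RTree.node i {t}) =
      MvPowerSeries.coeff (Finsupp.single t.root 1) (F i) * treeCoeff F t := by
  classical
  cases nonempty_fintype I
  obtain ⟨P, -, hP1, hP⟩ := exists_trunc F (t.weight + 1) (Finsupp.single t.root 1)
  have h := treeCoeff_node hP i (Finsupp.single t 1) (by simp)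
  rw [Finsupp.toMultiset_single, one_nsmul] at h
  have ht := isInf_treeForm (K := K) t
  rw [h, ← treeForm_apply, ← counit_leftOp ht, ← leftDer_apply ht, derivation_aeval, map_sum,
    Finset.sum_eq_single t.root]
  · rw [map_mul, counit_aeval_trunc, leftDer_apply, counit_leftOp ht, treeForm_apply,
      coeff_trunc_single _ _ _ (Nat.le_succ _), constantCoeff_eq, coeff_pderiv]
    simp [hP1]
  · intro k _ hk
    rw [map_mul, leftDer_apply, counit_leftOp ht, treeForm_apply,
      coeff_trunc_single_of_ne F _ hk.symm, mul_zero]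
  · simp

/-- L_f applied to the truncated equation, by the cocycle and chain rules. The error had degree at
least N + 1, and L_f lowers degrees by at most w. -/
theorem leftOp_trunc [Fintype I]
    (hP : ∀ i, trunc F N i - graftPoly i (aeval (trunc F N) (P i)) ∈
      weightSub K (fun a b => a ≤ b) ((N : ℤ) + 1))
    {f : HopfTree K I →ₗ[K] K} (hf : IsInf f) {w : ℕ} (hw : ∀ t, f (X t) ≠ 0 → t.weight ≤ w)
    (i : I) :
    leftOp f (trunc F N i) - (f (graftPoly i (aeval (trunc F N) (P i))) • 1 +
      graftPoly i (∑ k, aeval (trunc F N) (pderiv k (P i)) * leftOp f (trunc F N k))) ∈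
        weightSub K (fun a b => a ≤ b) ((N : ℤ) + 1 - w) := by
  have h := leftOp_mem_weightSub isWeightRel_le hf (w := w) (fun t ht => by
    have := hw t ht
    omega) (hP i)
  rwa [map_sub, leftOp_graftPoly, ← leftDer_apply hf (aeval _ _), derivation_aeval] at h

/-- When f kills the X_i, the family (L_f X_i) solves a homogeneous linear system whose right-hand
side is in the image of B_i^+, which raises the degree; hence it vanishes up to the degree of the
error. -/
theorem leftOp_trunc_mem [Fintype I]
    (hP : ∀ i, trunc F N i - graftPoly i (aeval (trunc F N) (P i)) ∈
      weightSub K (fun a b => a ≤ b) ((N : ℤ) + 1))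
    {f : HopfTree K I →ₗ[K] K} (hf : IsInf f) {w : ℕ} (hw : ∀ t, f (X t) ≠ 0 → t.weight ≤ w)
    (hwN : w ≤ N) (h0 : ∀ i, f (trunc F N i) = 0) (i : I) :
    leftOp f (trunc F N i) ∈ weightSub K (fun a b => a ≤ b) ((N : ℤ) + 1 - w) := by
  have hf0 : ∀ i, f (graftPoly i (aeval (trunc F N) (P i))) = 0 := by
    intro i
    have h1 := hf.eq_zero_of_mem (fun t ht => by
      by_contra hne
      have := hw t hne
      omega) (hP i)
    rw [map_sub, h0, zero_sub, neg_eq_zero] at h1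
    exact h1
  -- Each substitution into the system gains one degree, until the degree N + 1 − w of the error is
  -- reached.
  have key : ∀ m : ℕ, ∀ i, leftOp f (trunc F N i) ∈
      weightSub K (fun a b => a ≤ b) (min (m : ℤ) ((N : ℤ) + 1 - w)) := by
    intro m
    induction m with
    | zero => exact fun i => weightSub_le_anti (min_le_left _ _) (mem_weightSub_le_zero _)
    | succ m ih =>
      intro i
      have h1 := leftOp_trunc hP hf hw i
      rw [hf0, zero_smul, zero_add] at h1
      have h2 := graftPoly_mem_weightSub isWeightRel_le i (Submodule.sum_mem _ fun k
        (_ : k ∈ Finset.univ) => mul_mem_weightSub isWeightRel_le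
          (mem_weightSub_le_zero (aeval (trunc F N) (pderiv k (P i)))) (ih k))
      have h3 := add_mem (weightSub_le_anti (min_le_right ((m + 1 : ℕ) : ℤ) _) h1)
        (weightSub_le_anti (by push_cast; omega) h2)
      rwa [sub_add_cancel] at h3
  exact weightSub_le_anti (by simp) (key (N + 1) i)

theorem comp_mem_weightSub (F : I → MvPowerSeries I K) (i : I) (n : ℕ) :
    comp F i n ∈ weightSub K (fun a b => a = b) n := by
  classical
  intro e he
  rw [coeff_comp] at he
  split_ifs at he with h
  · exact congrArg _ h.symm
  · exact absurd rfl he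

theorem coeff_leftOp_comp_of_ne (F : I → MvPowerSeries I K) (i : I) (n : ℕ)
    {f : HopfTree K I →ₗ[K] K} (hf : IsInf f) {w : ℕ} (hw : ∀ t, f (X t) ≠ 0 → t.weight = w)
    {s : RTree I} (hs : s.weight + w ≠ n) :
    coeff (Finsupp.single s 1) (leftOp f (comp F i n)) = 0 := by
  by_contra h
  have := leftOp_mem_weightSub isWeightRel_eq hf (w := w) (fun t ht => by
    rw [hw t ht, sub_self]) (comp_mem_weightSub F i n) _ h
  rw [forestWeight_single] at this
  omega

theorem coeff_leftOp_trunc (F : I → MvPowerSeries I K) (i : I) (N : ℕ)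
    {f : HopfTree K I →ₗ[K] K} (hf : IsInf f) {w : ℕ} (hw : ∀ t, f (X t) ≠ 0 → t.weight = w)
    {s : RTree I} (hs : s.weight + w ≤ N) :
    coeff (Finsupp.single s 1) (leftOp f (trunc F N i)) =
      coeff (Finsupp.single s 1) (leftOp f (comp F i (s.weight + w))) := by
  rw [trunc, map_sum, coeff_sum, Finset.sum_eq_single (s.weight + w)]
  · exact fun n _ hn => coeff_leftOp_comp_of_ne F i n hf hw hn.symm
  · intro h
    rw [Finset.mem_range] at h
    omega

/-- A cut leaves the root in R^c, so every tree in L_f X_i(n) still has its root decorated by i. -/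
theorem coeff_leftOp_comp_of_root_ne (F : I → MvPowerSeries I K) {i : I} (n : ℕ)
    (f : HopfTree K I →ₗ[K] K) {s : RTree I} (hs : s.root ≠ i) :
    coeff (Finsupp.single s 1) (leftOp f (comp F i n)) = 0 := by
  classical
  rw [comp_eq_sum, map_sum, coeff_sum]
  refine Finset.sum_eq_zero fun t ht => ?_
  rw [map_smul, coeff_smul]
  rw [← RTree.node_root_children t, (mem_trees.1 ht).1, ← graftPoly_prod, leftOp_graftPoly,
    coeff_add, coeff_single_graftPoly_of_ne _ hs, coeff_smul, coeff_one,
    if_neg (Finsupp.single_ne_zero.2 one_ne_zero).symm]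
  simp

/-! ### Hopf systems -/

theorem comp_mem_HS (F : I → MvPowerSeries I K) (i : I) (n : ℕ) : comp F i n ∈ HS F :=
  Algebra.subset_adjoin ⟨i, n, rfl⟩

/-- The form f consumes the left factor of Δ(x), and the right factors lie in H_(S). -/
theorem leftOp_mem_HS (hS : IsHopf F) (f : HopfTree K I →ₗ[K] K) {x : HopfTree K I}
    (hx : x ∈ HS F) : leftOp f x ∈ HS F := by
  obtain ⟨z, hz⟩ := hS x hx
  rw [leftOp_apply, ← hz]
  clear hz
  induction z with
  | zero => simp
  | add a b ha hb =>
    simp only [map_add]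
    exact add_mem ha hb
  | tmul a b =>
    simp only [tensorIncl, TensorProduct.map_tmul, LinearMap.rTensor_tmul, TensorProduct.lid_tmul]
    exact Subalgebra.smul_mem _ b.2 _

/-- A tree coefficient is an infinitesimal character, hence sees only the part of x linear in the
generators; c(i, n) is the coefficient of X_i(n) in that part. It depends on t only through its root
and weight. -/
theorem exists_coeff_of_mem_HS {x : HopfTree K I} (hx : x ∈ HS F) :
    ∃ c : I → ℕ → K, ∀ t, coeff (Finsupp.single t 1) x = c t.root t.weight * treeCoeff F t := by
  classical
  induction hx using Algebra.adjoin_induction with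
  | mem x hx =>
    obtain ⟨i, n, rfl⟩ := hx
    refine ⟨fun j m => if j = i ∧ m = n then 1 else 0, fun t => ?_⟩
    rw [coeff_single_comp]
    simp
  | algebraMap r =>
    refine ⟨0, fun t => ?_⟩
    rw [algebraMap_eq, coeff_C, if_neg (Finsupp.single_ne_zero.2 one_ne_zero).symm]
    simp
  | add x y _ _ hx hy =>
    obtain ⟨c, hc⟩ := hx
    obtain ⟨d, hd⟩ := hy
    exact ⟨c + d, fun t => by rw [coeff_add, hc, hd, Pi.add_apply, Pi.add_apply, add_mul]⟩
  | mul x y _ _ hx hy =>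
    obtain ⟨c, hc⟩ := hx
    obtain ⟨d, hd⟩ := hy
    refine ⟨fun i n => c i n * counit K I y + counit K I x * d i n, fun t => ?_⟩
    rw [← treeForm_apply, isInf_treeForm t, treeForm_apply, treeForm_apply, hc, hd]
    ring

theorem sum_cutNumber (F : I → MvPowerSeries I K) (i : I) (n : ℕ) (p s : RTree I) :
    ∑ t ∈ trees i n, (RTree.cutNumber p s t : K) * treeCoeff F t =
      coeff (Finsupp.single s 1) (leftOp (treeForm K p) (comp F i n)) := by
  rw [comp_eq_sum, map_sum, coeff_sum]
  refine Finset.sum_congr rfl fun t _ => ?_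
  rw [map_smul, coeff_smul, coeff_leftOp_treeForm, smul_eq_mul, mul_comm]

theorem exists_isStructureCoeff (hS : IsHopf F) : ∃ lam, IsStructureCoeff F lam := by
  choose c hc using fun (i j : I) (n : ℕ+) => exists_coeff_of_mem_HS
    (leftOp_mem_HS hS (treeForm K (RTree.dot j)) (comp_mem_HS F i (n + 1)))
  refine ⟨fun i j n => c i j n i n, fun i j n s hs => ?_⟩
  obtain ⟨hs1, hs2⟩ := mem_trees.1 hs
  rw [sum_cutNumber, hc, hs1, hs2]

end

end

section

variable {K I : Type*} [Field K]

/-! ### The linear terms of a Hopf system -/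

theorem dot_injective : Function.Injective (RTree.dot : I → RTree I) := fun i j h => by
  simpa [RTree.dot] using congrArg RTree.root h

@[simp]
theorem weight_dot (i : I) : (RTree.dot i).weight = 1 := by
  simp [RTree.dot, RTree.weight_node]

theorem eq_dot_of_weight {t : RTree I} (h : t.weight = 1) : t = RTree.dot t.root := by
  rw [← RTree.node_root_children t, RTree.weight_node] at h
  have h0 : t.children = 0 := by
    refine Multiset.eq_zero_of_forall_notMem fun s hs => ?_
    have h2 : s.weight ≤ (t.children.map RTree.weight).sum :=
      Multiset.single_le_sum (fun _ _ => Nat.zero_le _) _ (Multiset.mem_map_of_mem _ hs)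
    have := s.weight_pos
    omega
  conv_lhs => rw [← RTree.node_root_children t, h0]
  rfl

/-- The projection on the polynomials in the trees with one vertex. -/
noncomputable def dotProj (K I : Type*) [Field K] :
    HopfTree K I →ₐ[K] MvPolynomial I K :=
  killCompl (dot_injective (I := I))

theorem dotProj_X_of_weight_ne {t : RTree I} (h : t.weight ≠ 1) : dotProj K I (X t) = 0 := by
  rw [dotProj, killCompl, aeval_X, dif_neg]
  rintro ⟨i, rfl⟩
  exact h (weight_dot i)

theorem dotProj_X_dot (i : I) : dotProj K I (X (RTree.dot i)) = X i := by
  have := killCompl_rename_app (dot_injective (I := I)) (X i : MvPolynomial I K)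
  rwa [rename_X] at this

theorem constantCoeff_dotProj (x : HopfTree K I) :
    constantCoeff (dotProj K I x) = counit K I x := by
  rw [counit_eq, constantCoeff_eq, constantCoeff_eq, dotProj, coeff_killCompl,
    Finsupp.mapDomain_zero]

theorem forestWeight_mapDomain_dot (d : I →₀ ℕ) :
    forestWeight (d.mapDomain RTree.dot) = d.degree := by
  induction d using Finsupp.induction_linear with
  | zero => simp
  | add a b ha hb => rw [Finsupp.mapDomain_add, forestWeight_add, ha, hb, map_add]
  | single i n =>
    rw [Finsupp.mapDomain_single, forestWeight, Finsupp.weight_single, weight_dot]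
    simp

section

variable [Finite I]

theorem dotProj_trunc (F : I → MvPowerSeries I K)
    (hF1 : ∀ i, MvPowerSeries.constantCoeff (F i) = 1) {N : ℕ} (hN : 1 ≤ N) (i : I) :
    dotProj K I (trunc F N i) = X i := by
  rw [trunc, map_sum, Finset.sum_eq_single 1]
  · rw [comp_eq_sum, map_sum, Finset.sum_eq_single (RTree.dot i)]
    · rw [map_smul, dotProj_X_dot, treeCoeff_dot F hF1, one_smul]
    · intro t ht hti
      obtain ⟨h1, h2⟩ := mem_trees.1 ht
      exact absurd (h1 ▸ eq_dot_of_weight h2) hti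
    · intro h
      exact absurd (mem_trees.2 ⟨RTree.root_node _ _, weight_dot i⟩) h
  · intro n _ hn
    rw [comp_eq_sum, map_sum]
    refine Finset.sum_eq_zero fun t ht => ?_
    rw [map_smul, dotProj_X_of_weight_ne (by rw [(mem_trees.1 ht).2]; exact hn), smul_zero]
  · intro h
    rw [Finset.mem_range] at h
    omega

/-- Modulo the trees with several vertices, X_i is its single vertex. So the coefficients of P can
be read off P(X) on the forests of single vertices. -/
theorem dotProj_aeval_trunc (F : I → MvPowerSeries I K)
    (hF1 : ∀ i, MvPowerSeries.constantCoeff (F i) = 1) {N : ℕ} (hN : 1 ≤ N)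
    (P : MvPolynomial I K) : dotProj K I (aeval (trunc F N) P) = P := by
  rw [← AlgHom.comp_apply, comp_aeval]
  simp only [dotProj_trunc F hF1 hN]
  exact aeval_X_left_apply P

/-- Otherwise let d = d' + e_j be an exponent of least positive degree in F_i, so that d' ≠ 0, and
let s be the corolla with root i and leaves d'. By minimality a_s = 0, so the Hopf property makes
the coefficient of s in L_f X_i vanish, where f is the coefficient of the single vertex j. The chain
rule computes this coefficient as d_j times the coefficient of d in F_i, which is nonzero. -/
theorem exists_linear_coeff_ne_zero [CharZero K] {F : I → MvPowerSeries I K}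
    (hF1 : ∀ i, MvPowerSeries.constantCoeff (F i) = 1) {i : I}
    (hFnc : ∀ c : K, F i ≠ MvPowerSeries.C c) (hS : IsHopf F) :
    ∃ k, MvPowerSeries.coeff (Finsupp.single k 1) (F i) ≠ 0 := by
  classical
  cases nonempty_fintype I
  by_contra! hlin
  have hex : ∃ m, ∃ d : I →₀ ℕ, d.degree = m ∧ d ≠ 0 ∧ MvPowerSeries.coeff d (F i) ≠ 0 := by
    by_contra! h
    refine hFnc 1 ?_
    ext d
    by_cases hd : d = 0
    · rw [hd, MvPowerSeries.coeff_zero_eq_constantCoeff_apply, hF1]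
      simp
    · rw [h _ d rfl hd, MvPowerSeries.coeff_C, if_neg hd]
  obtain ⟨d, hdm, hd0, hd⟩ := Nat.find_spec hex
  have hmin : ∀ d' : I →₀ ℕ, d' ≠ 0 → d'.degree < d.degree →
      MvPowerSeries.coeff d' (F i) = 0 := by
    intro d' h0 hlt
    by_contra hne
    exact Nat.find_min hex (hdm ▸ hlt) ⟨d', rfl, h0, hne⟩
  obtain ⟨j, hj⟩ := Finsupp.ne_iff.1 hd0
  rw [Finsupp.zero_apply] at hj
  obtain ⟨d', rfl⟩ : ∃ d', d = d' + Finsupp.single j 1 :=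
    ⟨d - Finsupp.single j 1, (tsub_add_cancel_of_le (by simpa [Nat.one_le_iff_ne_zero])).symm⟩
  have hd'0 : d' ≠ 0 := by
    rintro rfl
    rw [zero_add] at hd
    exact hd (hlin j)
  have hdeg : (d' + Finsupp.single j 1).degree = d'.degree + 1 := by
    rw [map_add, Finsupp.degree_single]
  -- The weight of s is deg d' + 1, and one more vertex is needed for the leaf that is cut.
  set N := d'.degree + 2 with hN
  obtain ⟨P, hP01, hPd, hP⟩ := exists_trunc F N (d' + Finsupp.single j 1)
  have hPmin : ∀ d'' : I →₀ ℕ, d'' ≠ 0 → d''.degree ≤ d'.degree → coeff d'' (P i) = 0 := by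
    intro d'' h0 hle
    rcases hP01 i d'' with h | h
    · rw [h, hmin d'' h0 (by omega)]
    · exact h
  set e := d'.mapDomain RTree.dot with he
  have hew : forestWeight e = d'.degree := forestWeight_mapDomain_dot d'
  set s := RTree.node i (Finsupp.toMultiset e) with hs
  have hsw : s.weight = d'.degree + 1 := by rw [hs, weight_node_toMultiset, hew]
  have hf := isInf_treeForm (K := K) (RTree.dot j)
  have hfw : ∀ t, treeForm K (RTree.dot j) (X t) ≠ 0 → t.weight = 1 := fun t ht => by
    rw [treeForm_X_ne_zero ht, weight_dot]
  have hs0 : treeCoeff F s = 0 := by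
    rw [hs, treeCoeff_node hP i e (by omega)]
    have := coeff_killCompl (dot_injective (I := I)) (p := aeval (trunc F N) (P i)) (s := d')
    rw [← he] at this
    rw [← this]
    change coeff d' (dotProj K I _) = 0
    rw [dotProj_aeval_trunc F hF1 (by omega), hPmin d' hd'0 le_rfl]
  have h1 : coeff (Finsupp.single s 1) (leftOp (treeForm K (RTree.dot j)) (trunc F N i)) = 0 := by
    rw [coeff_leftOp_trunc F i N hf hfw (by omega)]
    obtain ⟨c, hc⟩ := exists_coeff_of_mem_HS
      (leftOp_mem_HS hS (treeForm K (RTree.dot j)) (comp_mem_HS F i (s.weight + 1)))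
    rw [hc, hs0, mul_zero]
  rw [coeff_eq_of_sub_mem (leftOp_trunc hP hf (fun t ht => (hfw t ht).le) i)
    (by rw [forestWeight_single]; push_cast; omega), coeff_add, coeff_smul, coeff_one,
    if_neg (Finsupp.single_ne_zero.2 one_ne_zero).symm, smul_zero, zero_add, hs,
    coeff_single_graftPoly] at h1
  have h2 := coeff_killCompl (dot_injective (I := I)) (s := d')
    (p := ∑ k, aeval (trunc F N) (pderiv k (P i)) *
      leftOp (treeForm K (RTree.dot j)) (trunc F N k))
  rw [← he, h1] at h2
  change coeff d' (dotProj K I _) = 0 at h2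
  rw [map_sum, coeff_sum] at h2
  -- By minimality ∂_k P_i has no term of degree less than deg d', so only the constant term of L_f
  -- X_k counts; it is f(X_k), that is 1 if k = j and 0 otherwise.
  have h3 : ∀ k, coeff d' (dotProj K I (aeval (trunc F N) (pderiv k (P i)) *
      leftOp (treeForm K (RTree.dot j)) (trunc F N k))) =
        coeff d' (pderiv k (P i)) * (if j = k then 1 else 0) := by
    intro k
    rw [map_mul, dotProj_aeval_trunc F hF1 (by omega), coeff_mul, Finset.sum_eq_single (d', 0)]
    · congr 1
      rw [← constantCoeff_eq, constantCoeff_dotProj, counit_leftOp hf, treeForm_apply]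
      split_ifs with hjk
      · subst hjk
        have := coeff_trunc_single F N (RTree.dot j) (by rw [weight_dot]; omega)
        rwa [treeCoeff_dot F hF1, RTree.dot, RTree.root_node] at this
      · exact coeff_trunc_single_of_ne F N (by rwa [RTree.dot, RTree.root_node])
    · rintro ⟨a, b⟩ hab hne
      rw [Finset.HasAntidiagonal.mem_antidiagonal] at hab
      change a + b = d' at hab
      have hb : b ≠ 0 := by
        rintro rfl
        rw [add_zero] at hab
        exact hne (by rw [hab])
      have hb' : 0 < b.degree := by
        rw [pos_iff_ne_zero, Ne, Finsupp.degree_eq_zero_iff]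
        exact hb
      have hdeg' : a.degree + b.degree = d'.degree := by rw [← map_add, hab]
      rw [coeff_pderiv, hPmin (a + Finsupp.single k 1), zero_mul, zero_mul]
      · intro h
        simpa using congrArg (fun x => x k) h
      · rw [map_add, Finsupp.degree_single]
        omega
    · intro h
      exact absurd (by simp) h
  simp only [h3, mul_ite, mul_one, mul_zero, Finset.sum_ite_eq, Finset.mem_univ, if_true] at h2
  rw [coeff_pderiv, hPd] at h2
  exact mul_ne_zero hd (by exact_mod_cast Nat.succ_ne_zero (d' j)) h2

/-- The homogeneous components of positive degree of the solution of a Hopf system are not zero. -/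
theorem exists_treeCoeff_ne_zero [CharZero K] {F : I → MvPowerSeries I K}
    (hF1 : ∀ i, MvPowerSeries.constantCoeff (F i) = 1)
    (hFnc : ∀ i, ∀ c : K, F i ≠ MvPowerSeries.C c) (hS : IsHopf F) (i : I) (n : ℕ+) :
    ∃ t : RTree I, t.root = i ∧ t.weight = n ∧ treeCoeff F t ≠ 0 := by
  induction n using PNat.recOn generalizing i with
  | one => exact ⟨RTree.dot i, RTree.root_node _ _, weight_dot i, by simp [treeCoeff_dot F hF1]⟩
  | succ n ih =>
    obtain ⟨k, hk⟩ := exists_linear_coeff_ne_zero hF1 (hFnc i) hS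
    obtain ⟨t, rfl, ht, ht0⟩ := ih k
    -- A ladder: its coefficient is that of t times the nonzero coefficient of h_k in F_i.
    refine ⟨RTree.node i {t}, RTree.root_node _ _, ?_, ?_⟩
    · rw [RTree.weight_node, Multiset.map_singleton, Multiset.sum_singleton, ht, PNat.add_coe,
        PNat.one_coe, add_comm]
    · rw [treeCoeff_node_singleton]
      exact mul_ne_zero hk ht0

/-- Cutting a tree or a leaf with the same root decoration acts in the same way on the solution. -/
theorem coeff_leftOp_treeForm_eq {F : I → MvPowerSeries I K}
    (hF1 : ∀ i, MvPowerSeries.constantCoeff (F i) = 1) {p : RTree I} (hp : treeCoeff F p ≠ 0)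
    (i : I) (s : RTree I) :
    (treeCoeff F p)⁻¹ *
        coeff (Finsupp.single s 1) (leftOp (treeForm K p) (comp F i (s.weight + p.weight))) =
      coeff (Finsupp.single s 1)
        (leftOp (treeForm K (RTree.dot p.root)) (comp F i (s.weight + 1))) := by
  classical
  cases nonempty_fintype I
  have hpw := p.weight_pos
  -- With w the weight of p, `leftOp_trunc_mem` gives vanishing below degree N + 1 − w, just enough
  -- to include s.
  set N := s.weight + p.weight with hN
  obtain ⟨P, -, -, hP⟩ := exists_trunc F N 0
  have h1 := isInf_treeForm (K := K) p
  have h2 := isInf_treeForm (K := K) (RTree.dot p.root)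
  have hf : IsInf ((treeCoeff F p)⁻¹ • treeForm K p - treeForm K (RTree.dot p.root)) :=
    (h1.smul _).sub h2
  have hw : ∀ t, ((treeCoeff F p)⁻¹ • treeForm K p - treeForm K (RTree.dot p.root)) (X t) ≠ 0 →
      t.weight ≤ p.weight := by
    intro t ht
    by_contra hlt
    refine ht ?_
    have e1 : treeForm K p (X t) = 0 := by
      by_contra h
      exact hlt (by rw [treeForm_X_ne_zero h])
    have e2 : treeForm K (RTree.dot p.root) (X t) = 0 := by
      by_contra h
      exact hlt (by rw [treeForm_X_ne_zero h, weight_dot]; exact hpw)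
    rw [LinearMap.sub_apply, LinearMap.smul_apply, e1, e2, smul_zero, sub_zero]
  have h0 : ∀ k, ((treeCoeff F p)⁻¹ • treeForm K p - treeForm K (RTree.dot p.root))
      (trunc F N k) = 0 := by
    intro k
    rw [LinearMap.sub_apply, LinearMap.smul_apply, treeForm_apply, treeForm_apply, smul_eq_mul]
    by_cases hk : p.root = k
    · subst hk
      have e3 := coeff_trunc_single F N (RTree.dot p.root) (by rw [weight_dot]; omega)
      rw [treeCoeff_dot F hF1, RTree.dot, RTree.root_node] at e3
      rw [coeff_trunc_single F N p (by omega), RTree.dot, e3, inv_mul_cancel₀ hp, sub_self]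
    · rw [coeff_trunc_single_of_ne F N hk, coeff_trunc_single_of_ne F N
        (by rwa [RTree.dot, RTree.root_node]), mul_zero, sub_zero]
  have key := leftOp_trunc_mem hP hf hw (by omega) h0 i
  have hz : coeff (Finsupp.single s 1)
      (leftOp ((treeCoeff F p)⁻¹ • treeForm K p - treeForm K (RTree.dot p.root))
        (trunc F N i)) = 0 := by
    by_contra hne
    have := key _ hne
    rw [forestWeight_single] at this
    omega
  rw [leftOp_sub, leftOp_smul, LinearMap.sub_apply, LinearMap.smul_apply, coeff_sub, coeff_smul,
    coeff_leftOp_trunc F i N h1 (fun t ht => by rw [treeForm_X_ne_zero ht]) le_rfl,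
    coeff_leftOp_trunc F i N h2 (w := 1) (fun t ht => by rw [treeForm_X_ne_zero ht, weight_dot])
      (by omega), sub_eq_zero] at hz
  exact hz

end

end

section

variable {K I : Type*} [Field K]

/-! ### Primitive elements of the graded duals -/

theorem mem_primDual {A : Subalgebra K (HopfTree K I)} {f : A →ₗ[K] K} :
    f ∈ PrimDual A ↔
      (∃ N : ℕ, ∀ n, N ≤ n → ∀ x : A, IsHomog (x : HopfTree K I) n → f x = 0) ∧
        ∀ x y : A, f (x * y) = f x * counit K I y + counit K I x * f y := by
  refine and_congr Iff.rfl ⟨fun h x y => ?_, fun h => TensorProduct.ext' fun x y => ?_⟩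
  · simpa [tensorForm] using LinearMap.congr_fun h (x ⊗ₜ[K] y)
  · simpa [tensorForm] using h x y

/-- The infinitesimal characters of the algebra of trees that belong to its graded dual. -/
def infSub (K I : Type*) [Field K] : Submodule K (HopfTree K I →ₗ[K] K) where
  carrier := {f | IsInf f ∧ ∃ N : ℕ, ∀ t : RTree I, N ≤ t.weight → f (X t) = 0}
  zero_mem' := ⟨fun x y => by simp, 0, fun _ _ => rfl⟩
  add_mem' := by
    rintro f g ⟨hf, N, hN⟩ ⟨hg, M, hM⟩
    refine ⟨hf.add hg, max N M, fun t ht => ?_⟩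
    rw [LinearMap.add_apply, hN t ((le_max_left _ _).trans ht), hM t ((le_max_right _ _).trans ht),
      add_zero]
  smul_mem' := by
    rintro c f ⟨hf, N, hN⟩
    exact ⟨hf.smul c, N, fun t ht => by rw [LinearMap.smul_apply, hN t ht, smul_zero]⟩

theorem IsHomog.mem_weightSub {x : HopfTree K I} {n : ℕ} (hx : IsHomog x n) :
    x ∈ weightSub K (fun a b => a ≤ b) (n : ℤ) :=
  fun _ he => Int.ofNat_le.2 (hx he).ge

/-- The restriction to a subalgebra of the infinitesimal characters. -/
noncomputable def restrictInf (A : Subalgebra K (HopfTree K I)) :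
    infSub K I →ₗ[K] PrimDual A :=
  LinearMap.codRestrict (PrimDual A)
    ((LinearMap.lcomp K K A.val.toLinearMap) ∘ₗ (infSub K I).subtype) (by
      rintro ⟨f, hf, N, hN⟩
      refine mem_primDual.2 ⟨⟨N, fun n hn x hx => ?_⟩, fun x y => hf x y⟩
      exact hf.eq_zero_of_mem (fun t ht => hN t (by omega)) hx.mem_weightSub)

@[simp]
theorem restrictInf_apply (A : Subalgebra K (HopfTree K I)) (f : infSub K I) (x : A) :
    (restrictInf A f).1 x = f.1 x := rfl

theorem infMul_mem {f g : HopfTree K I →ₗ[K] K} (hf : f ∈ infSub K I) (hg : g ∈ infSub K I) :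
    infMul f g ∈ infSub K I := by
  obtain ⟨hf, N, hN⟩ := hf
  obtain ⟨hg, M, hM⟩ := hg
  refine ⟨isInf_infMul f g, N + M, fun t ht => ?_⟩
  rw [infMul_X]
  have h := leftOp_X_mem_weightSub isWeightRel_le hf (w := N) (fun t ht => by
    by_contra hlt
    exact ht (hN t (by omega))) t
  exact hg.eq_zero_of_mem (fun s hs => hM s (by omega)) h

/-- The pre-Lie product of the primitive elements of the graded dual of the algebra of trees. -/
noncomputable def infStar (K I : Type*) [Field K] :
    infSub K I →ₗ[K] infSub K I →ₗ[K] infSub K I :=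
  LinearMap.mk₂ K (fun f g => ⟨infMul f.1 g.1, infMul_mem f.2 g.2⟩)
    (fun f f' g => Subtype.ext (IsInf.ext (isInf_infMul _ _)
      ((isInf_infMul _ _).add (isInf_infMul _ _)) fun t => by simp [leftOp_add]))
    (fun c f g => Subtype.ext (IsInf.ext (isInf_infMul _ _)
      ((isInf_infMul _ _).smul c) fun t => by simp [leftOp_smul]))
    (fun f g g' => Subtype.ext (IsInf.ext (isInf_infMul _ _)
      ((isInf_infMul _ _).add (isInf_infMul _ _)) fun t => by simp))
    (fun c f g => Subtype.ext (IsInf.ext (isInf_infMul _ _)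
      ((isInf_infMul _ _).smul c) fun t => by simp))

@[simp]
theorem infStar_coe (f g : infSub K I) : (infStar K I f g).1 = infMul f.1 g.1 := rfl

theorem apply_leftOp (f g : HopfTree K I →ₗ[K] K) (x : HopfTree K I) :
    g (leftOp f x) = tensorForm f g (comul K I x) := by
  rw [leftOp_apply]
  induction comul K I x with
  | zero => simp
  | tmul a b => simp [tensorForm]
  | add a b ha hb => simp only [map_add, ha, hb]

theorem tensorForm_map_treeProj {f g : HopfTree K I →ₗ[K] K} (hf : IsInf f) (hg : IsInf g)
    (z : HopfTree K I ⊗[K] HopfTree K I) :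
    tensorForm f g (TensorProduct.map (treeProj K I) (treeProj K I) z) = tensorForm f g z := by
  induction z with
  | zero => simp
  | tmul a b => simp [tensorForm, hf.treeProj, hg.treeProj]
  | add a b ha hb => simp only [map_add, ha, hb]

theorem topForm_mem (f : PrimDual (⊤ : Subalgebra K (HopfTree K I))) :
    topForm f.1 ∈ infSub K I := by
  obtain ⟨⟨N, hN⟩, hmul⟩ := mem_primDual.1 f.2
  refine ⟨fun x y => hmul ⟨x, Algebra.mem_top⟩ ⟨y, Algebra.mem_top⟩, N, fun t ht => ?_⟩
  exact hN t.weight ht ⟨X t, Algebra.mem_top⟩ (isWeightedHomogeneous_X K RTree.weight t)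

theorem topForm_restrictInf (f : infSub K I) : topForm (restrictInf ⊤ f).1 = f.1 := rfl

theorem treeForm_mem (t : RTree I) : treeForm K t ∈ infSub K I :=
  ⟨isInf_treeForm t, t.weight + 1, fun s hs => by
    by_contra h
    rw [treeForm_X_ne_zero h] at hs
    omega⟩

-- Restriction of infinitesimal characters to H_(S), and descent of the pre-Lie product.

section

variable [Finite I] {F : I → MvPowerSeries I K}

/-- A primitive element is determined on products by its values on the factors, hence by its values
on the generators of H_(S). -/
theorem gS_ext {f g : gS F} (h : ∀ i n, f.1 (compS F i n) = g.1 (compS F i n)) : f = g := by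
  have hf := (mem_primDual.1 f.2).2
  have hg := (mem_primDual.1 g.2).2
  have one : ∀ {u : HS F →ₗ[K] K},
      (∀ x y : HS F, u (x * y) = u x * counit K I y + counit K I x * u y) → u 1 = 0 := by
    intro u hu
    simpa using hu 1 1
  refine Subtype.ext (LinearMap.ext ?_)
  rintro ⟨x, hx⟩
  induction hx using Algebra.adjoin_induction with
  | mem x hx =>
    obtain ⟨i, n, rfl⟩ := hx
    exact h i n
  | algebraMap r =>
    have e : (⟨algebraMap K (HopfTree K I) r, (HS F).algebraMap_mem r⟩ : HS F) = r • 1 :=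
      Subtype.ext (Algebra.algebraMap_eq_smul_one r)
    change f.1 ⟨_, (HS F).algebraMap_mem r⟩ = g.1 ⟨_, (HS F).algebraMap_mem r⟩
    rw [e, map_smul, map_smul, one hf, one hg]
  | add x y hx hy h1 h2 =>
    have e := congrArg₂ (· + ·) h1 h2
    simp only [← map_add] at e
    exact e
  | mul x y hx hy h1 h2 =>
    have e1 := hf ⟨x, hx⟩ ⟨y, hy⟩
    rw [h1, h2, ← hg] at e1
    exact e1

theorem infMul_comp (f g : HopfTree K I →ₗ[K] K) (i : I) (n : ℕ) :
    infMul f g (comp F i n) = g (leftOp f (comp F i n)) := by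
  simp only [comp_eq_sum, map_sum, map_smul, infMul_X]

theorem apply_leftOp_coe (hS : IsHopf F) (f g : HopfTree K I →ₗ[K] K) (x : HS F) :
    g (leftOp f x) = tensorForm (f ∘ₗ (HS F).val.toLinearMap) (g ∘ₗ (HS F).val.toLinearMap)
      (comulS hS x) := by
  rw [apply_leftOp, ← tensorIncl_comulS hS]
  induction comulS hS x with
  | zero => simp
  | tmul a b => simp [tensorForm, tensorIncl]
  | add a b ha hb => simp only [map_add, ha, hb]

theorem restrictInf_infStar_compS (hS : IsHopf F) (f g : infSub K I) (i : I) (n : ℕ) :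
    (restrictInf (HS F) (infStar K I f g)).1 (compS F i n) =
      tensorForm (restrictInf (HS F) f).1 (restrictInf (HS F) g).1 (comulS hS (compS F i n)) := by
  rw [restrictInf_apply, infStar_coe]
  exact (infMul_comp _ _ i n).trans (apply_leftOp_coe hS _ _ (compS F i n))

/-- On X_i(n) the product is (f ⊗ g) ∘ Δ with Δ(X_i(n)) in H_(S) ⊗ H_(S), so it uses only the
restrictions. This makes ⋆ well defined on g_(S). -/
theorem restrictInf_infStar_congr (hS : IsHopf F) {f f' g g' : infSub K I}
    (hf : restrictInf (HS F) f = restrictInf (HS F) f')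
    (hg : restrictInf (HS F) g = restrictInf (HS F) g') :
    restrictInf (HS F) (infStar K I f g) = restrictInf (HS F) (infStar K I f' g') :=
  gS_ext fun i n => by
    rw [restrictInf_infStar_compS hS, restrictInf_infStar_compS hS, hf, hg]

theorem compS_zero (i : I) : compS F i 0 = 0 := by
  refine Subtype.ext ?_
  change comp F i 0 = 0
  rw [comp_eq_sum]
  exact Finset.sum_eq_zero fun t ht => absurd (mem_trees.1 ht).2 t.weight_pos.ne'

open Classical in
/-- A family of primitive elements dual to the homogeneous components of the solution is a
basis. -/
theorem exists_basis_of_dual {b : I × ℕ+ → gS F}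
    (hb : ∀ (i j : I) (k l : ℕ+), (b (i, k)).1 (compS F j l) = if i = j ∧ k = l then 1 else 0) :
    ∃ B : Module.Basis (I × ℕ+) K (gS F), ⇑B = b := by
  cases nonempty_fintype I
  have hsum : ∀ (T : Finset (I × ℕ+)) (c : I × ℕ+ → K) (j : I) (l : ℕ+),
      (∑ p ∈ T, c p • b p : gS F).1 (compS F j l) = if (j, l) ∈ T then c (j, l) else 0 := by
    intro T c j l
    rw [← Finset.sum_ite_eq' T (j, l) c]
    simp only [Submodule.coe_sum, LinearMap.sum_apply, Submodule.coe_smul, LinearMap.smul_apply]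
    refine Finset.sum_congr rfl fun p _ => ?_
    obtain ⟨i, k⟩ := p
    rw [hb, smul_eq_mul, mul_ite, mul_one, mul_zero]
    simp only [Prod.mk.injEq]
  have hli : LinearIndependent K b := by
    have hval : ∀ (c : I × ℕ+ →₀ K) (p : I × ℕ+),
        (Finsupp.linearCombination K b c).1 (compS F p.1 p.2) = c p := by
      intro c p
      rw [Finsupp.linearCombination_apply, Finsupp.sum, hsum]
      split_ifs with hp
      · rfl
      · exact (Finsupp.notMem_support_iff.1 hp).symm
    intro c c' h
    ext p
    rw [← hval c, ← hval c', h]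
  have hsp : ⊤ ≤ Submodule.span K (Set.range b) := by
    intro f _
    obtain ⟨N, hN⟩ := (mem_primDual.1 f.2).1
    -- The sum is finite because f vanishes in degrees at least N; `N.succPNat` is a positive
    -- integer beyond N.
    have hf : f = ∑ p ∈ Finset.univ ×ˢ Finset.Icc 1 N.succPNat,
        f.1 (compS F p.1 p.2) • b p := by
      refine gS_ext fun j n => ?_
      rcases Nat.eq_zero_or_pos n with rfl | hn
      · rw [compS_zero, map_zero, map_zero]
      · have h := hsum (Finset.univ ×ˢ Finset.Icc 1 N.succPNat)
          (fun p => f.1 (compS F p.1 p.2)) j ⟨n, hn⟩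
        rw [PNat.mk_coe] at h
        rw [h]
        split_ifs with hm
        · rfl
        · refine hN n ?_ _ ?_
          · by_contra hlt
            refine hm (Finset.mem_product.2 ⟨Finset.mem_univ _, Finset.mem_Icc.2
              ⟨one_le, ?_⟩⟩)
            rw [← PNat.coe_le_coe, PNat.mk_coe, Nat.succPNat_coe]
            omega
          · intro e he
            exact_mod_cast (comp_mem_weightSub F j n e he).symm
    rw [hf]
    exact Submodule.sum_mem _ fun p _ =>
      Submodule.smul_mem _ _ (Submodule.subset_span (Set.mem_range_self p))
  exact ⟨Module.Basis.mk hli hsp, Module.Basis.coe_mk hli hsp⟩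

theorem tensorForm_map_treeProjS (f g : infSub K I) (z : HS F ⊗[K] HS F) :
    tensorForm (restrictInf (HS F) f).1 (restrictInf (HS F) g).1
      (TensorProduct.map (treeProjS F) (treeProjS F) z) =
        tensorForm (restrictInf (HS F) f).1 (restrictInf (HS F) g).1 z := by
  have h : ∀ (u : infSub K I) (x : HS F),
      (restrictInf (HS F) u).1 (treeProjS F x) = (restrictInf (HS F) u).1 x :=
    fun u x => u.2.1.treeProj x
  induction z with
  | zero => simp
  | tmul a b => simp only [TensorProduct.map_tmul, tensorForm, LinearMap.comp_apply, h]
  | add a b ha hb => simp only [map_add, ha, hb]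

/-- Once π is dropped, the condition is linear in x, so it amounts to its values on the X_i(n),
which determine h. -/
theorem isPreLieProdS_restrictInf_iff (hS : IsHopf F) (f g : infSub K I) (h : gS F) :
    IsPreLieProdS hS (restrictInf (HS F) f) (restrictInf (HS F) g) h ↔
      h = restrictInf (HS F) (infStar K I f g) := by
  simp only [IsPreLieProdS, tensorForm_map_treeProjS]
  constructor
  · intro hh
    refine gS_ext fun i n => ?_
    rw [hh _ (Submodule.subset_span ⟨(i, n), rfl⟩), restrictInf_infStar_compS hS]
  · rintro rfl x hx
    refine LinearMap.eqOn_span (f := (restrictInf (HS F) (infStar K I f g)).1)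
      (g := tensorForm (restrictInf (HS F) f).1 (restrictInf (HS F) g).1 ∘ₗ comulS hS) ?_ hx
    rintro _ ⟨⟨i, n⟩, rfl⟩
    exact restrictInf_infStar_compS hS f g i n

end

end

end DSE


-- The pre-Lie structure of g_(S) and its multiplication table.

theorem proposition21 {K : Type*} [Field K] [CharZero K] {I : Type*} [Finite I] [Nonempty I]
    (F : I → MvPowerSeries I K)
    (hF1 : ∀ i, MvPowerSeries.constantCoeff (F i) = 1)
    (hFnc : ∀ i, ∀ c : K, F i ≠ MvPowerSeries.C c)
    (hS : DSE.IsHopf F) :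
    ∃ star : DSE.gS F →ₗ[K] DSE.gS F →ₗ[K] DSE.gS F,
      -- `f ⋆ g` is the unique element of `g_(S)` given by `(f ⊗ g) ∘ (π ⊗ π) ∘ Δ` on the `X_i(n)`
      (∀ f g h, DSE.IsPreLieProdS hS f g h ↔ h = star f g) ∧
      -- it is a pre-Lie product
      (∀ f g h, star (star f g) h - star f (star g h) = star (star g f) h - star g (star f h)) ∧
      -- it induces the Lie bracket of `g_(S)`
      (∀ f g, ((star f g - star g f : DSE.gS F) : DSE.HS F →ₗ[K] K) =
        DSE.dualMul hS f g - DSE.dualMul hS g f) ∧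
      -- it is inherited from the pre-Lie product of the primitive elements of the dual of the
      -- whole algebra of trees, by restriction of linear forms
      (∀ f g : DSE.PrimDual (⊤ : Subalgebra K (DSE.HopfTree K I)), ∀ f₁ g₁ : DSE.gS F,
        (∀ x : DSE.HS F, f₁.1 x = DSE.topForm f.1 x) →
        (∀ x : DSE.HS F, g₁.1 x = DSE.topForm g.1 x) →
        ∃ h, DSE.IsPreLieProdTree f g h ∧
          ∀ x : DSE.HS F, (star f₁ g₁).1 x = DSE.topForm h.1 x) ∧
      -- the structure coefficients exist
      (∃ lam, DSE.IsStructureCoeff F lam) ∧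
      -- the dual basis and the multiplication table
      ∃ b : Module.Basis (I × ℕ+) K (DSE.gS F),
        (∀ (i j : I) (k l : ℕ+), (b (i, k)).1 (DSE.compS F j l) =
          open Classical in if i = j ∧ k = l then 1 else 0) ∧
        ∀ lam, DSE.IsStructureCoeff F lam → ∀ (i j : I) (k l : ℕ+),
          star (b (j, l)) (b (i, k)) = lam i j k • b (i, k + l) := by
  classical
  choose s hroot hweight hcoeff using DSE.exists_treeCoeff_ne_zero hF1 hFnc hS
  -- Extensions of the dual basis to the whole algebra: the coefficient of one tree with nonzero
  -- coefficient in X_i(k), normalized.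
  let β : I × ℕ+ → DSE.infSub K I := fun p =>
    (DSE.treeCoeff F (s p.1 p.2))⁻¹ • ⟨DSE.treeForm K (s p.1 p.2), DSE.treeForm_mem _⟩
  have hβ : ∀ (i : I) (k : ℕ+), (β (i, k)).1 =
      (DSE.treeCoeff F (s i k))⁻¹ • DSE.treeForm K (s i k) := fun i k => rfl
  have hdual : ∀ (i j : I) (k l : ℕ+),
      (DSE.restrictInf (DSE.HS F) (β (i, k))).1 (DSE.compS F j l) =
        if i = j ∧ k = l then 1 else 0 := by
    intro i j k l
    rw [DSE.restrictInf_apply, hβ, LinearMap.smul_apply, DSE.treeForm_apply]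
    change _ • MvPolynomial.coeff _ (DSE.comp F j l) = _
    simp only [DSE.coeff_single_comp, hroot, hweight, PNat.coe_inj, smul_eq_mul, mul_ite, mul_zero,
      inv_mul_cancel₀ (hcoeff i k)]
  obtain ⟨b, hb⟩ := DSE.exists_basis_of_dual
    (b := fun p => DSE.restrictInf (DSE.HS F) (β p)) hdual
  let res := DSE.restrictInf (DSE.HS F)
  -- A linear section of the restriction map, which is therefore surjective; by `hstar` the product
  -- does not depend on this choice of extensions.
  let σ : DSE.gS F →ₗ[K] DSE.infSub K I := b.constr K β
  have hσ : ∀ f, res (σ f) = f := by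
    intro f
    have h : res ∘ₗ σ = LinearMap.id := b.ext fun p => by
      rw [LinearMap.comp_apply, b.constr_basis, hb]
      rfl
    exact LinearMap.congr_fun h f
  let star : DSE.gS F →ₗ[K] DSE.gS F →ₗ[K] DSE.gS F :=
    ((DSE.infStar K I).compl₁₂ σ σ).compr₂ res
  have hstar : ∀ f g, star (res f) (res g) = res (DSE.infStar K I f g) := fun f g =>
    DSE.restrictInf_infStar_congr hS (hσ (res f)) (hσ (res g))
  have hsurj : Function.Surjective res := fun f => ⟨σ f, hσ f⟩
  refine ⟨star, ?_, ?_, ?_, ?_, DSE.exists_isStructureCoeff hS, b, ?_, ?_⟩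
  · intro f g h
    obtain ⟨f, rfl⟩ := hsurj f
    obtain ⟨g, rfl⟩ := hsurj g
    rw [hstar]
    exact DSE.isPreLieProdS_restrictInf_iff hS f g h
  · intro f g h
    obtain ⟨f, rfl⟩ := hsurj f
    obtain ⟨g, rfl⟩ := hsurj g
    obtain ⟨h, rfl⟩ := hsurj h
    simp only [hstar]
    refine (map_sub res _ _).symm.trans (Eq.trans ?_ (map_sub res _ _))
    exact congrArg res (Subtype.ext (DSE.infMul_preLie f.2.1 g.2.1 h.1))
  · intro f g
    obtain ⟨f, rfl⟩ := hsurj f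
    obtain ⟨g, rfl⟩ := hsurj g
    rw [hstar, hstar]
    refine LinearMap.ext fun x => ?_
    refine (DSE.infMul_sub_infMul f.2.1 g.2.1 (x : DSE.HopfTree K I)).trans ?_
    rw [DSE.apply_leftOp_coe hS, DSE.apply_leftOp_coe hS]
    rfl
  · intro f g f₁ g₁ hf hg
    let f' : DSE.infSub K I := ⟨DSE.topForm f.1, DSE.topForm_mem f⟩
    let g' : DSE.infSub K I := ⟨DSE.topForm g.1, DSE.topForm_mem g⟩
    obtain rfl : f₁ = res f' := Subtype.ext (LinearMap.ext hf)
    obtain rfl : g₁ = res g' := Subtype.ext (LinearMap.ext hg)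
    refine ⟨DSE.restrictInf ⊤ (DSE.infStar K I f' g'), fun t => ?_, fun x => ?_⟩
    · rw [DSE.tensorForm_map_treeProj (DSE.topForm_mem f).1 (DSE.topForm_mem g).1,
        DSE.topForm_restrictInf, DSE.infStar_coe, DSE.infMul_X, DSE.apply_leftOp]
    · rw [hstar]
      rfl
  · intro i j k l
    rw [hb, hdual]
  · intro lam hlam i j k l
    simp only [hb]
    rw [hstar]
    -- Both sides vanish on X_m(n) unless m = i and n = k + l. There, cutting the tree chosen for
    -- (j, l), once normalized, amounts to cutting a leaf j, and the definition of λ applies to the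
    -- tree chosen for (i, k).
    refine DSE.gS_ext fun m n => ?_
    have e1 : (res (DSE.infStar K I (β (j, l)) (β (i, k)))).1 (DSE.compS F m n) =
        (DSE.treeCoeff F (s i k))⁻¹ * ((DSE.treeCoeff F (s j l))⁻¹ *
          MvPolynomial.coeff (Finsupp.single (s i k) 1)
            (DSE.leftOp (DSE.treeForm K (s j l)) (DSE.comp F m n))) := by
      refine (DSE.infMul_comp _ _ m n).trans ?_
      rw [hβ, hβ, DSE.leftOp_smul]
      simp only [LinearMap.smul_apply, map_smul, DSE.treeForm_apply, smul_eq_mul]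
      ring
    have e2 : (lam i j k • DSE.restrictInf (DSE.HS F) (β (i, k + l)) : DSE.gS F).1
        (DSE.compS F m n) = lam i j k * ((DSE.treeCoeff F (s i (k + l)))⁻¹ *
          MvPolynomial.coeff (Finsupp.single (s i (k + l)) 1) (DSE.comp F m n)) := rfl
    rw [e1, e2, DSE.coeff_single_comp, hroot, hweight]
    by_cases hm : i = m
    · subst hm
      by_cases hn : ((k + l : ℕ+) : ℕ) = n
      · subst hn
        have h1 := DSE.coeff_leftOp_treeForm_eq hF1 (hcoeff j l) i (s i k)
        have h2 := hlam i j k (s i k) (DSE.mem_trees.2 ⟨hroot i k, hweight i k⟩)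
        rw [DSE.sum_cutNumber] at h2
        rw [hroot, hweight, hweight, h2] at h1
        rw [PNat.add_coe, h1, if_pos ⟨rfl, rfl⟩, inv_mul_cancel₀ (hcoeff i (k + l)), mul_one,
          mul_left_comm, inv_mul_cancel₀ (hcoeff i k), mul_one]
      · rw [if_neg fun h => hn h.2, DSE.coeff_leftOp_comp_of_ne F i n
          (DSE.isInf_treeForm (s j l)) (w := (s j l).weight)
          (fun t ht => by rw [DSE.treeForm_X_ne_zero ht])
          (by rwa [hweight, hweight, ← PNat.add_coe])]
        simp
    · rw [if_neg fun h => hm h.1, DSE.coeff_leftOp_comp_of_root_ne F n _ (by rwa [hroot])]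
      simp
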